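/- Let $\zeta$ be the Riemann zeta-function, and let $\xi$ be the entire function with $\xi(s)=\tfrac12\,\pi^{-s/2}\,2\Gamma(1+\tfrac s2)\,(s-1)\,\zeta(s)$ (continued across the removable singularities $s=1,-2,-4,\dots$). Put $$n(s)=\sin(\pi s/4)\cdot 2\xi(\tfrac12+s),\qquad f(s)=\frac1{n(s)},\qquad c(z)=\frac1{n'(z)}\ \text{ where } n'(z)\neq0 .$$ Write $(z)_m=\prod_{0\le k\le m-1}(z+k)$ for the Pochhammer symbol, and for integers $k\ge 0$ let $$\tilde c(4k)=\frac{1}{\pi^{3/4}\,\Gamma(\tfrac54+2k)\,(2k-\tfrac14)\,\zeta(\tfrac12+4k)} .$$ Define $$P_0(z)=\frac{4}{\pi^{3/4}\Gamma(1/4)}\cdot(-1)\sum_{k\ge1}\frac{(-z^2)^k}{(5/4)_{2k}\,(2k-\tfrac14)\,\zeta(\tfrac12+4k)},$$ and, for integers $w\ge1$, $$P_{4w}(z)=(-1)^w\Big(P_0(z)+\sum_{1\le k\le w}\tilde c(4k)(-z^2)^k\Big).$$ Let $F(s)=\sum_{w\ge1}\dfrac{c(4w)}{s-4w}$ and $p_r(s)=\dfrac{c(0)}{s}+F(s)-F(-s)$.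 Let $Z_i$ be the set of nonreal zeros of $s\mapsto\zeta(\tfrac12+s)$. Then, without any unproven hypothesis: (1) The series defining $P_0$ converges for every $z\in\mathbb C$, and $P_0$ is an even entire function. On the strip $\tfrac12<\operatorname{Re}(s)<4$, $f$ is analytic and $$f(s)=\int_{\mathbb R}e^{sy}\,P_0(\pi e^{-2y})\,dy,$$ the integral being absolutely convergent. (2) $n'(4k)\ne0$ for every integer $k$, and the series $F(s)$ converges absolutely for every $s\notin\{4,8,12,\dots\}$. The function $f-p_r$ has an analytic extension from $\mathbb C\setminus(4\mathbb Z\cup Z_i)$ to $\mathbb C\setminus Z_i$. The set $\mathbb C\setminus Z_i$ is open and contains every $s$ with $|\operatorname{Re}(s)|\ge\tfrac12$. (3) For every $s$ with $\operatorname{Re}(s)<4$, $$F(s)=\int_0^\infty e^{sy}\,P_0(\pi e^{-2y})\,dy,$$ the integral being absolutely convergent. (4) Let $w\ge1$ be an integer. Then $P_{4w}$ is entire, with $P_{4w}(z)=(-1)^{w+1}\sum_{k\ge w+1}\tilde c(4k)(-z^2)^k$ for all $z\in\mathbb C$. On the strip $4w<\operatorname{Re}(s)<4w+4$, $f$ is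 analytic and $$(-1)^w f(s)=\int_{\mathbb R}e^{sy}\,P_{4w}(\pi e^{-2y})\,dy,$$ the integral being absolutely convergent. Moreover $P_{4w}(\pi e^{-2y})$ is real and $P_{4w}(\pi e^{-2y})>0$ for all real $y$. -/

import Mathlib

open MeasureTheory Set Complex

noncomputable section

namespace ZetaLaplace

/-- `l(s) = π^{-s/2} · 2Γ(1 + s/2)`. -/
def l (s : ℂ) : ℂ := (Real.pi : ℂ) ^ (-s / 2) * (2 * Gamma (1 + s / 2))

/-- `a(s) = l(s)(s - 1)`. -/
def a (s : ℂ) : ℂ := l s * (s - 1)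

/-- Riemann's entire function `ξ`, the analytic continuation of `(1/2) a(s) ζ(s)`.
With `Λ(s) = π^{-s/2} Γ(s/2) ζ(s) = Λ₀(s) - 1/s - 1/(1-s)`, this is `ξ(s) = s(s-1)Λ(s)/2`, written
through the entire function `Λ₀` so that the values at the removable singularities `s = 1` and
`s = -2, -4, …` of `(1/2) a(s) ζ(s)` are the right ones; see `xi_eq` and `differentiable_xi`. -/
def xi (s : ℂ) : ℂ := (s * (s - 1) * completedRiemannZeta₀ s + 1) / 2

theorem differentiable_xi : Differentiable ℂ xi := by
  have h := differentiable_completedZeta₀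
  unfold xi
  fun_prop

/-- Away from the removable singularities, `ξ(s) = (1/2) a(s) ζ(s)`. -/
theorem xi_eq {s : ℂ} (h1 : s ≠ 1) (h2 : ∀ m : ℕ, s ≠ -2 * (m + 1)) :
    xi s = 1 / 2 * a s * riemannZeta s := by
  by_cases h0 : s = 0
  · subst h0
    norm_num [xi, a, l, riemannZeta_zero]
  have hs1 : 1 - s ≠ 0 := sub_ne_zero.mpr (Ne.symm h1)
  have hG : Gammaℝ s ≠ 0 := by
    rw [Ne, Gammaℝ_eq_zero_iff]
    rintro ⟨n, hn⟩
    cases n with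
    | zero => exact h0 (by simpa using hn)
    | succ m => exact h2 m (by rw [hn]; push_cast; ring)
  have hl : l s = s * Gammaℝ s := by
    rw [l, Gammaℝ_def, add_comm, Gamma_add_one _ (div_ne_zero h0 two_ne_zero)]
    ring
  rw [xi, a, hl, riemannZeta_def_of_ne_zero h0, completedRiemannZeta_eq]
  field_simp
  ring

/-- `n(s) = sin(πs/4) · 2ξ(1/2 + s)`. -/
def n (s : ℂ) : ℂ := sin (Real.pi * s / 4) * (2 * xi (1 / 2 + s))

/-- The meromorphic function `f(s) = 1/n(s)`. -/
def f (s : ℂ) : ℂ := 1 / n s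

/-- `c(z) = 1/n'(z)`. -/
def c (z : ℂ) : ℂ := 1 / deriv n z

/-- The open vertical strip `x₀ < Re s < x₁`. -/
def strip (x₀ x₁ : ℝ) : Set ℂ := {s | x₀ < s.re ∧ s.re < x₁}

/-- The Pochhammer symbol `(z)_m = ∏_{0 ≤ k ≤ m-1} (z + k)`. -/
def poch (z : ℂ) (m : ℕ) : ℂ := ∏ k ∈ Finset.range m, (z + k)

/-- `ctilde k` is the coefficient
`c̃(4k) = 1/(π^{3/4} Γ(5/4 + 2k) (2k - 1/4) ζ(1/2 + 4k))`. -/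
def ctilde (k : ℕ) : ℂ :=
  1 / (((Real.pi ^ (3 / 4 : ℝ) : ℝ) : ℂ) * Gamma (5 / 4 + 2 * k) * (2 * k - 1 / 4)
    * riemannZeta (1 / 2 + 4 * k))

/-- The `k`-th term of the explicit power series of `P₀`:
`(4/(π^{3/4} Γ(1/4))) · (-1) · (-z²)^k / ((5/4)_{2k} (2k - 1/4) ζ(1/2 + 4k))`. -/
def P0Term (z : ℂ) (k : ℕ) : ℂ :=
  4 / (((Real.pi ^ (3 / 4 : ℝ) : ℝ) : ℂ) * Gamma (1 / 4))
    * (-1 * ((-z ^ 2) ^ k / (poch (5 / 4) (2 * k) * (2 * k - 1 / 4) * riemannZeta (1 / 2 + 4 * k))))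

/-- `P₀(z)`: the sum over `k ≥ 1` of the explicit power series (the index is shifted by one). -/
def P0 (z : ℂ) : ℂ := ∑' k : ℕ, P0Term z (k + 1)

/-- `P w z` is `P_{4w}(z) = (-1)^w (P₀(z) + ∑_{1 ≤ k ≤ w} c̃(4k) (-z²)^k)`. -/
def P (w : ℕ) (z : ℂ) : ℂ :=
  (-1) ^ w * (P0 z + ∑ k ∈ Finset.Icc 1 w, ctilde k * (-z ^ 2) ^ k)

/-- The `w`-th term (`w ≥ 1`) of the partial fraction series `F`: `c(4w)/(s - 4w)`. -/
def FTerm (s : ℂ) (w : ℕ) : ℂ := c (4 * w) / (s - 4 * w)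

/-- `F(s) = ∑_{w ≥ 1} c(4w)/(s - 4w)` (the index is shifted by one). -/
def F (s : ℂ) : ℂ := ∑' w : ℕ, FTerm s (w + 1)

/-- `p_r(s) = c(0)/s + F(s) - F(-s)`. -/
def pr (s : ℂ) : ℂ := c 0 / s + F s - F (-s)

/-- `4ℤ`, as a subset of `ℂ`. -/
def fourZ : Set ℂ := {s | ∃ k : ℤ, s = 4 * k}

/-- `4ℕ = {4, 8, 12, …}`, as a subset of `ℂ`. -/
def fourN : Set ℂ := {s | ∃ k : ℕ, 1 ≤ k ∧ s = 4 * k}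

/-- `Z_i`: the nonreal zeros of `s ↦ ζ(1/2 + s)`. -/
def Zi : Set ℂ := {s | riemannZeta (1 / 2 + s) = 0 ∧ s.im ≠ 0}

/-- The integrand `y ↦ e^{sy} Q(π e^{-2y})` of the Laplace representations. -/
def laplaceIntegrand (Q : ℂ → ℂ) (s : ℂ) (y : ℝ) : ℂ :=
  exp (s * y) * Q ((Real.pi * Real.exp (-2 * y) : ℝ) : ℂ)

end ZetaLaplace

end

/-! The mechanism is a moment formula. Up to a positive constant, `ctilde k` is 1/(2k)! times the
2k-th moment of a signed kernel: 1/(2k - 1/4) is a power integral over (0,1), the Gamma quotient is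
a Beta integral, and 1/ζ(1/2 + 4k) is a Möbius Dirichlet series (`dilMoment`). So on the positive
axis P_{4w} is a superposition of dilates of `cosRem w`, a signed Taylor remainder of cosine
(`P_ofReal`).

The Mellin transform turns such a superposition into a product (`mellin_integral_dilate`). One
factor is the moment at a complex exponent. The other, found through the Laplace transform of
`cosRem w`, converges on 4w < Re s < 4w + 4 and contributes 1/sin(πs/4) (`mellin_cosRem`). The
substitution x = π e^{-2y} then gives the two-sided Laplace integrals (`laplace_P`).

For w ≥ 1 the remainder is convex on [0,∞) and vanishes at 0, so contracting its argument by 1/m²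
shrinks it at least by that factor. In the Möbius sum over m, the terms with m ≥ 2 therefore total
at most π²/6 - 1 < 1 times the term m = 1, which gives positivity (`moebius_cosRem_pos`).

For the poles, an alternating series excludes zeros of ζ in (0,1). Together with nonvanishing on Re
≥ 1 and the functional equation, this shows that the zeros of ξ(1/2 + s) are nonreal, so `n` has
simple zeros on 4ℤ. The residues c(4k) = (-π²)^k c̃(4k) are absolutely summable, so the partial
fraction series converges and cancels the real poles of `f`. The same identity makes P₀(π e^{-2y})
an exponential series, which integrates term by term over y > 0. -/

noncomputable section

namespace ZetaLaplace

/-! ### Taylor remainders of cosine and sine: sign, convexity, power series -/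

/-- The remainder `(-1)^(w+1) (cos x - ∑_{k ≤ w} (-1)^k x^{2k}/(2k)!)`. -/
def cosRem : ℕ → ℝ → ℝ
  | 0, x => 1 - Real.cos x
  | w + 1, x => x ^ (2 * w + 2) / (2 * w + 2).factorial - cosRem w x

/-- The remainder `(-1)^(w+1) (sin x - ∑_{k ≤ w} (-1)^k x^{2k+1}/(2k+1)!)`. -/
def sinRem : ℕ → ℝ → ℝ
  | 0, x => x - Real.sin x
  | w + 1, x => x ^ (2 * w + 3) / (2 * w + 3).factorial - sinRem w x

theorem hasDerivAt_pow_div_factorial (m : ℕ) (x : ℝ) :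
    HasDerivAt (fun x : ℝ => x ^ (m + 1) / (m + 1).factorial) (x ^ m / m.factorial) x := by
  have h := (hasDerivAt_pow (m + 1) x).div_const ((m + 1).factorial : ℝ)
  refine h.congr_deriv ?_
  rw [Nat.factorial_succ, Nat.add_sub_cancel]
  have := Nat.factorial_ne_zero m
  push_cast
  field_simp

theorem hasDerivAt_sinRem (w : ℕ) (x : ℝ) : HasDerivAt (sinRem w) (cosRem w x) x := by
  induction w with
  | zero => exact (hasDerivAt_id x).sub (Real.hasDerivAt_sin x)
  | succ w ih => exact (hasDerivAt_pow_div_factorial (2 * w + 2) x).sub ih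

theorem hasDerivAt_cosRem_succ (w : ℕ) (x : ℝ) :
    HasDerivAt (cosRem (w + 1)) (sinRem w x) x := by
  induction w with
  | zero =>
    have h := (hasDerivAt_pow_div_factorial 1 x).sub
      ((hasDerivAt_const x (1 : ℝ)).sub (Real.hasDerivAt_cos x))
    have e : cosRem (0 + 1) = (fun x : ℝ => x ^ (1 + 1) / ((1 + 1).factorial : ℝ)) -
        ((fun _ => (1 : ℝ)) - Real.cos) := by
      ext y; simp [cosRem]
    rw [e]
    refine h.congr_deriv ?_
    simp [sinRem]
  | succ w ih => exact (hasDerivAt_pow_div_factorial (2 * w + 3) x).sub ih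

theorem cosRem_zero_right (w : ℕ) : cosRem w 0 = 0 := by
  induction w with
  | zero => simp [cosRem]
  | succ w ih => simp [cosRem, ih]

theorem sinRem_zero_right (w : ℕ) : sinRem w 0 = 0 := by
  induction w with
  | zero => simp [sinRem]
  | succ w ih => simp [sinRem, ih]

theorem continuous_cosRem (w : ℕ) : Continuous (cosRem w) := by
  induction w with
  | zero => exact continuous_const.sub Real.continuous_cos
  | succ w ih => exact ((continuous_pow _).div_const _).sub ih

theorem pos_of_hasDerivAt_pos {g g' : ℝ → ℝ} (hg : ∀ x, HasDerivAt g (g' x) x)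
    (h0 : g 0 = 0) (h : ∀ x, 0 < x → 0 < g' x) {x : ℝ} (hx : 0 < x) : 0 < g x := by
  have : StrictMonoOn g (Ici 0) := strictMonoOn_of_deriv_pos (convex_Ici 0)
    (fun y _ => (hg y).continuousAt.continuousWithinAt) fun y hy => by
      rw [interior_Ici] at hy
      rw [(hg y).deriv]; exact h y hy
  simpa [h0] using this self_mem_Ici hx.le hx

/-- Each remainder vanishes at 0 and has the preceding one as derivative, so positivity climbs the
chain from sin x < x. It starts at `cosRem 1` because 1 - cos x has zeros at the multiples of 2π. -/
theorem sinRem_pos_and_cosRem_pos (w : ℕ) :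
    (∀ x, 0 < x → 0 < sinRem w x) ∧ ∀ x, 0 < x → 0 < cosRem (w + 1) x := by
  induction w with
  | zero =>
    have h : ∀ x, 0 < x → 0 < sinRem 0 x := fun x hx => sub_pos.2 (Real.sin_lt hx)
    exact ⟨h, fun x hx => pos_of_hasDerivAt_pos (hasDerivAt_cosRem_succ 0) (cosRem_zero_right _) h hx⟩
  | succ w ih =>
    have h : ∀ x, 0 < x → 0 < sinRem (w + 1) x := fun x hx =>
      pos_of_hasDerivAt_pos (hasDerivAt_sinRem (w + 1)) (sinRem_zero_right _) ih.2 hx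
    exact ⟨h, fun x hx =>
      pos_of_hasDerivAt_pos (hasDerivAt_cosRem_succ (w + 1)) (cosRem_zero_right _) h hx⟩

theorem cosRem_nonneg (w : ℕ) {x : ℝ} (hx : 0 ≤ x) : 0 ≤ cosRem w x := by
  cases w with
  | zero => exact sub_nonneg.2 (Real.cos_le_one x)
  | succ w =>
    rcases hx.eq_or_lt with rfl | hx
    · rw [cosRem_zero_right]
    · exact ((sinRem_pos_and_cosRem_pos w).2 x hx).le

/-- The second derivative is `cosRem w`, which is nonnegative. -/
theorem convexOn_cosRem (w : ℕ) : ConvexOn ℝ (Ici 0) (cosRem (w + 1)) := by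
  refine convexOn_of_hasDerivWithinAt2_nonneg (f' := sinRem w) (f'' := cosRem w) (convex_Ici 0)
    (continuous_cosRem _).continuousOn (fun x _ => (hasDerivAt_cosRem_succ w x).hasDerivWithinAt)
    (fun x _ => (hasDerivAt_sinRem w x).hasDerivWithinAt) fun x hx => cosRem_nonneg w ?_
  rw [interior_Ici] at hx
  exact (mem_Ioi.1 hx).le

/-- Convexity on the segment from 0 to x, with value 0 at the left end. This linear gain in r drives
the positivity argument. -/
theorem cosRem_mul_le (w : ℕ) {x r : ℝ} (hx : 0 ≤ x) (hr : 0 ≤ r) (hr1 : r ≤ 1) :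
    cosRem (w + 1) (x * r) ≤ r * cosRem (w + 1) x := by
  have h := (convexOn_cosRem w).2 (x := x) (y := 0) hx self_mem_Ici hr (sub_nonneg.2 hr1) (by ring)
  simpa [cosRem_zero_right, mul_comm] using h

theorem hasSum_cosRem (w : ℕ) (x : ℝ) :
    HasSum (fun j : ℕ => (-1) ^ j * (x ^ (2 * (w + 1 + j)) / ((2 * (w + 1 + j)).factorial : ℝ)))
      (cosRem w x) := by
  induction w with
  | zero =>
    have h := (hasSum_nat_add_iff' 1).2 (Real.hasSum_cos x)
    have h2 := h.neg
    simp only [Finset.range_one, Finset.sum_singleton] at h2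
    have e : cosRem 0 x = -(Real.cos x - (-1) ^ 0 * x ^ (2 * 0) / ((2 * 0).factorial : ℝ)) := by
      simp [cosRem]
    rw [e]
    refine h2.congr_fun fun j => ?_
    rw [show 0 + 1 + j = j + 1 by ring]; ring
  | succ w ih =>
    have h := ((hasSum_nat_add_iff' 1).2 ih).neg
    simp only [Finset.range_one, Finset.sum_singleton] at h
    have e : cosRem (w + 1) x = -(cosRem w x - (-1) ^ 0 *
        (x ^ (2 * (w + 1 + 0)) / ((2 * (w + 1 + 0)).factorial : ℝ))) := by
      rw [show 2 * (w + 1 + 0) = 2 * w + 2 by ring]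
      simp only [cosRem]
      ring
    rw [e]
    refine h.congr_fun fun j => ?_
    rw [show w + 1 + 1 + j = w + 1 + (j + 1) by ring]; ring

/-! ### Laplace and Mellin transforms of the cosine remainders -/

theorem integral_exp_mul_cosRem (w : ℕ) {u : ℝ} (hu : 0 < u) :
    IntegrableOn (fun x => Real.exp (-(u * x)) * cosRem w x) (Ioi 0) ∧
      ∫ x in Ioi 0, Real.exp (-(u * x)) * cosRem w x = 1 / (u ^ (2 * w + 1) * (u ^ 2 + 1)) := by
  induction w with
  | zero =>
    have hre : (-(u : ℂ) + I).re < 0 := by simpa using hu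
    have i1 := integrableOn_exp_mul_complex_Ioi hre 0
    have v1 := integral_exp_mul_complex_Ioi hre 0
    have i0 := integrableOn_exp_mul_Ioi (neg_neg_of_pos hu) 0
    have v0 := integral_exp_mul_Ioi (neg_neg_of_pos hu) 0
    -- The cosine part is the real part of the exponential with rate -u + i.
    have e : (fun x : ℝ => Real.exp (-(u * x)) * cosRem 0 x) =
        fun x : ℝ => Real.exp (-u * x) - (cexp ((-(u : ℂ) + I) * x)).re := by
      ext x
      simp [cosRem, Complex.exp_re]
      ring
    rw [e]
    have i2 : IntegrableOn (fun x : ℝ => (cexp ((-(u : ℂ) + I) * x)).re) (Ioi 0) := i1.re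
    refine ⟨i0.sub i2, ?_⟩
    rw [integral_sub i0 i2, v0]
    have := integral_re i1
    simp only [RCLike.re_to_complex] at this
    rw [this, v1]
    have hn : (-(u : ℂ) + I) ≠ 0 := fun h => by simp [h] at hre
    simp [Complex.div_re, Complex.normSq_apply]
    field_simp
    ring
  | succ w ih =>
    -- The new monomial contributes 1/u^(2w+3), and subtracting the previous transform leaves the
    -- same shape with w + 1.
    have g := Real.integral_rpow_mul_exp_neg_mul_Ioi (a := (2 * w + 2 : ℕ) + 1) (r := u)
      (by positivity) hu
    have gi := integrableOn_rpow_mul_exp_neg_mul_rpow (s := (2 * w + 2 : ℕ)) (p := 1) (b := u)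
      (by have : (0 : ℝ) ≤ (2 * w + 2 : ℕ) := by positivity
          linarith) one_pos hu
    simp only [Real.rpow_one, Real.rpow_natCast, add_sub_cancel_right] at g gi
    rw [Real.Gamma_nat_eq_factorial] at g
    set N := (2 * w + 2).factorial with hN
    have hN0 : (N : ℝ) ≠ 0 := by exact_mod_cast Nat.factorial_ne_zero _
    have e : (fun x : ℝ => Real.exp (-(u * x)) * cosRem (w + 1) x) = fun x =>
        x ^ (2 * w + 2) * Real.exp (-u * x) / N - Real.exp (-(u * x)) * cosRem w x := by
      ext x
      simp only [cosRem, neg_mul, ← hN]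
      ring
    have gi' : IntegrableOn (fun x : ℝ => x ^ (2 * w + 2) * Real.exp (-u * x) / N) (Ioi 0) :=
      gi.div_const _
    rw [e]
    refine ⟨gi'.sub ih.1, ?_⟩
    rw [integral_sub gi' ih.1, ih.2, integral_div]
    simp only [neg_mul]
    rw [g]
    have e2 : ((1 / u) ^ (((2 * w + 2 : ℕ) : ℝ) + 1)) = 1 / u ^ (2 * w + 3) := by
      rw [show (((2 * w + 2 : ℕ) : ℝ) + 1) = ((2 * w + 3 : ℕ) : ℝ) by push_cast; ring,
        Real.rpow_natCast, div_pow, one_pow]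
    rw [e2, show 2 * (w + 1) + 1 = 2 * w + 3 by ring]
    field_simp
    ring

/-- If `L` is the Laplace transform of `R ≥ 0`, then `Γ(b) · ℳR(1 - b) = ℳL(b)`. -/
theorem mellin_of_laplace {R L : ℝ → ℝ} (hR : Measurable R) (hR0 : ∀ x, 0 < x → 0 ≤ R x)
    (hi : ∀ u, 0 < u → IntegrableOn (fun x => Real.exp (-(u * x)) * R x) (Ioi 0))
    (hv : ∀ u, 0 < u → ∫ x in Ioi 0, Real.exp (-(u * x)) * R x = L u)
    {b : ℂ} (hb : 0 < b.re) (hL : MellinConvergent (fun u => (L u : ℂ)) b) :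
    MellinConvergent (fun x => (R x : ℂ)) (1 - b) ∧
      Gamma b * mellin (fun x => (R x : ℂ)) (1 - b) = mellin (fun u => (L u : ℂ)) b := by
  set G : ℝ × ℝ → ℂ := fun p => ((p.1 : ℂ) ^ (b - 1) * (Real.exp (-(p.1 * p.2)) * R p.2 : ℝ)) with hG
  have hGm : AEStronglyMeasurable G ((volume.restrict (Ioi (0:ℝ))).prod (volume.restrict (Ioi 0))) := by
    refine Measurable.aestronglyMeasurable ?_
    have hR2 : Measurable fun p : ℝ × ℝ => R p.2 := hR.comp measurable_snd
    fun_prop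
  have hGi : Integrable G ((volume.restrict (Ioi (0:ℝ))).prod (volume.restrict (Ioi 0))) := by
    rw [integrable_prod_iff hGm]
    constructor
    · filter_upwards [ae_restrict_mem measurableSet_Ioi] with u hu
      exact Integrable.const_mul (Integrable.ofReal (𝕜 := ℂ) (hi u hu)) ((u : ℂ) ^ (b - 1))
    -- Since R ≥ 0, the inner integral of the norm is |u^(b-1)| L(u), so Tonelli reduces
    -- integrability on the product to the Mellin convergence of L.
    · refine (hL.norm).congr ?_
      filter_upwards [ae_restrict_mem measurableSet_Ioi] with u hu
      simp only [hG, norm_mul, Complex.norm_real, smul_eq_mul]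
      rw [integral_const_mul, ← hv u hu, Real.norm_of_nonneg]
      · congr 1
        refine setIntegral_congr_fun measurableSet_Ioi fun x hx => ?_
        rw [Real.norm_of_nonneg (Real.exp_pos _).le, Real.norm_of_nonneg (hR0 x hx)]
      · exact setIntegral_nonneg measurableSet_Ioi fun x hx =>
          mul_nonneg (Real.exp_pos _).le (hR0 x hx)
  have hin : ∀ x ∈ Ioi (0 : ℝ), ∫ u in Ioi (0 : ℝ), G (u, x) = Gamma b * ((x : ℂ) ^ (1 - b - 1) • (R x : ℂ)) := by
    intro x hx
    have := Complex.integral_cpow_mul_exp_neg_mul_Ioi hb (r := x) (by simpa using hx)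
    simp only [hG]
    push_cast
    simp only [← mul_assoc]
    rw [integral_mul_const]
    have e : ∀ u : ℝ, (u : ℂ) ^ (b - 1) * cexp (-(u * x)) = (u : ℂ) ^ (b - 1) * cexp (-(x * u)) := by
      intro u; rw [mul_comm (u : ℂ) x]
    simp only [e, this]
    rw [smul_eq_mul, show 1 - b - 1 = -b by ring, Complex.cpow_neg, one_div, Complex.inv_cpow]
    · ring
    · rw [Complex.arg_ofReal_of_nonneg (mem_Ioi.1 hx).le]; exact Real.pi_ne_zero.symm
  have hGam := Gamma_ne_zero_of_re_pos hb
  have h1 := hGi.integral_prod_right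
  have h1' : IntegrableOn (fun x : ℝ => Gamma b * ((x : ℂ) ^ (1 - b - 1) • (R x : ℂ))) (Ioi 0) :=
    IntegrableOn.congr_fun h1 hin measurableSet_Ioi
  refine ⟨?_, ?_⟩
  · have := h1'.const_mul (Gamma b)⁻¹
    refine IntegrableOn.congr_fun this (fun x _ => ?_) measurableSet_Ioi
    exact inv_mul_cancel_left₀ hGam _
  · rw [mellin, ← integral_const_mul, ← setIntegral_congr_fun measurableSet_Ioi hin,
      ← integral_prod_symm _ hGi, integral_prod _ hGi, mellin]
    refine setIntegral_congr_fun measurableSet_Ioi fun u hu => ?_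
    simp only [hG]
    rw [integral_const_mul, integral_complex_ofReal, hv u hu, smul_eq_mul]

theorem mellinConvergent_inv_one_add {b : ℂ} (hb : 0 < b.re) (hb1 : b.re < 1) :
    MellinConvergent (fun u : ℝ => ((1 / (1 + u) : ℝ) : ℂ)) b := by
  refine mellinConvergent_of_isBigO_rpow (a := 1) (b := 0) ?_ ?_ hb1 ?_ hb
  · refine ContinuousOn.locallyIntegrableOn ?_ measurableSet_Ioi
    refine Complex.continuous_ofReal.comp_continuousOn ?_
    refine continuousOn_const.div (by fun_prop) fun x hx => ?_
    have := mem_Ioi.1 hx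
    positivity
  · refine Asymptotics.IsBigO.of_bound 1 ?_
    filter_upwards [Filter.eventually_gt_atTop 0] with x hx
    rw [Complex.norm_real, Real.norm_of_nonneg (by positivity), Real.rpow_neg_one,
      Real.norm_of_nonneg (by positivity), one_mul, one_div]
    gcongr
    linarith
  · refine Asymptotics.IsBigO.of_bound 1 ?_
    filter_upwards [self_mem_nhdsWithin] with x hx
    have hx := mem_Ioi.1 hx
    rw [Complex.norm_real, Real.norm_of_nonneg (by positivity), neg_zero, Real.rpow_zero]
    rw [norm_one, one_mul, div_le_one (by positivity)]
    linarith

/-- Here 1/(1+u) is the Laplace transform of e^{-x}, so `mellin_of_laplace` gives Γ(b)Γ(1-b), and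
the reflection formula finishes. -/
theorem mellin_inv_one_add {b : ℂ} (hb : 0 < b.re) (hb1 : b.re < 1) :
    mellin (fun u : ℝ => ((1 / (1 + u) : ℝ) : ℂ)) b = Real.pi / sin (Real.pi * b) := by
  have hi : ∀ u : ℝ, 0 < u → IntegrableOn (fun x => Real.exp (-(u * x)) * Real.exp (-x)) (Ioi 0) := by
    intro u hu
    have := integrableOn_exp_mul_Ioi (a := -(1 + u)) (by linarith) 0
    refine this.congr_fun (fun x _ => ?_) measurableSet_Ioi
    dsimp only
    rw [← Real.exp_add]; congr 1; ring
  have hv : ∀ u : ℝ, 0 < u →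
      ∫ x in Ioi 0, Real.exp (-(u * x)) * Real.exp (-x) = 1 / (1 + u) := by
    intro u hu
    have := integral_exp_mul_Ioi (a := -(1 + u)) (by linarith) 0
    simp only [mul_zero, Real.exp_zero, neg_div_neg_eq] at this
    rw [← this]
    refine setIntegral_congr_fun measurableSet_Ioi fun x _ => ?_
    rw [← Real.exp_add]; congr 1; ring
  have h := (mellin_of_laplace (by fun_prop) (fun x _ => (Real.exp_pos _).le) hi hv hb
    (mellinConvergent_inv_one_add hb hb1)).2
  rw [← h, ← Complex.Gamma_mul_Gamma_one_sub,
    Complex.Gamma_eq_integral (s := 1 - b) (by simpa using hb1), Complex.GammaIntegral_eq_mellin]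

theorem mellin_inv_one_add_sq {a : ℂ} (ha : 0 < a.re) (ha2 : a.re < 2) :
    MellinConvergent (fun u : ℝ => ((1 / (1 + u ^ 2) : ℝ) : ℂ)) a ∧
    mellin (fun u : ℝ => ((1 / (1 + u ^ 2) : ℝ) : ℂ)) a =
      Real.pi / (2 * sin (Real.pi * a / 2)) := by
  have e : (fun u : ℝ => ((1 / (1 + u ^ 2) : ℝ) : ℂ)) =
      fun u : ℝ => (fun u : ℝ => ((1 / (1 + u) : ℝ) : ℂ)) (u ^ (2 : ℝ)) := by
    ext u; simp
  have h0 : 0 < (a / 2).re := by simpa using ha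
  have h1 : (a / 2).re < 1 := by
    have : (a / 2).re = a.re / 2 := by simp
    linarith
  rw [e]
  constructor
  · rw [MellinConvergent.comp_rpow (f := fun u : ℝ => ((1 / (1 + u) : ℝ) : ℂ)) two_ne_zero]
    simpa using mellinConvergent_inv_one_add h0 h1
  · rw [mellin_comp_rpow (fun u : ℝ => ((1 / (1 + u) : ℝ) : ℂ))]
    have := mellin_inv_one_add h0 h1
    push_cast at this ⊢
    rw [this, mul_div_assoc, Complex.real_smul, abs_of_pos two_pos]
    push_cast
    rw [← mul_div_assoc, inv_mul_eq_div, div_div]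

/-- By `mellin_of_laplace` with b = 1 + s/2, everything reduces to the Mellin transform of 1/(1+u²)
at a = s/2 - 2w. The bounds on Re s say exactly that 0 < Re a < 2. -/
theorem mellin_cosRem (w : ℕ) {s : ℂ} (h1 : 4 * w < s.re) (h2 : s.re < 4 * w + 4) :
    MellinConvergent (fun x => (cosRem w x : ℂ)) (-s / 2) ∧
    mellin (fun x => (cosRem w x : ℂ)) (-s / 2) =
      (-1) ^ w * (Real.pi / (2 * sin (Real.pi * s / 4) * Gamma (1 + s / 2))) := by
  have hs0 : 0 < s.re := lt_of_le_of_lt (by positivity) h1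
  have hsr : (s / 2).re = s.re / 2 := by simp
  set b : ℂ := 1 + s / 2 with hbdef
  have hb : 0 < b.re := by rw [hbdef, add_re, hsr, one_re]; positivity
  set a : ℂ := s / 2 - 2 * w with hadef
  have har : a.re = s.re / 2 - 2 * w := by rw [hadef, sub_re, hsr]; simp
  have ha := mellin_inv_one_add_sq (a := a) (by rw [har]; linarith) (by rw [har]; linarith)
  have hb' : b + -((2 * w + 1 : ℕ) : ℂ) = a := by rw [hbdef, hadef]; push_cast; ring
  have e : ∀ u ∈ Ioi (0 : ℝ), (u : ℂ) ^ (-((2 * w + 1 : ℕ) : ℂ)) • ((1 / (1 + u ^ 2) : ℝ) : ℂ) =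
      ((1 / (u ^ (2 * w + 1) * (u ^ 2 + 1)) : ℝ) : ℂ) := by
    intro u hu
    rw [Complex.cpow_neg, Complex.cpow_natCast, smul_eq_mul]
    push_cast
    rw [one_div, one_div, mul_inv, add_comm ((u : ℂ) ^ 2)]
  have hc : MellinConvergent (fun u : ℝ => ((1 / (u ^ (2 * w + 1) * (u ^ 2 + 1)) : ℝ) : ℂ)) b := by
    have := ha.1
    rw [← hb', ← MellinConvergent.cpow_smul] at this
    refine IntegrableOn.congr_fun this (fun u hu => ?_) measurableSet_Ioi
    simp only [e u hu]
  have hm : mellin (fun u : ℝ => ((1 / (u ^ (2 * w + 1) * (u ^ 2 + 1)) : ℝ) : ℂ)) b =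
      Real.pi / (2 * sin (Real.pi * a / 2)) := by
    have := mellin_cpow_smul (fun u : ℝ => ((1 / (1 + u ^ 2) : ℝ) : ℂ)) b (-((2 * w + 1 : ℕ) : ℂ))
    rw [hb'] at this
    rw [← ha.2, ← this]
    refine setIntegral_congr_fun measurableSet_Ioi (fun u hu => ?_)
    exact congrArg _ (e u hu).symm
  have key := mellin_of_laplace (continuous_cosRem w).measurable
    (fun x hx => cosRem_nonneg w hx.le) (fun u hu => (integral_exp_mul_cosRem w hu).1)
    (fun u hu => (integral_exp_mul_cosRem w hu).2) hb hc
  have hb1 : 1 - b = -s / 2 := by rw [hbdef]; ring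
  rw [hb1] at key
  refine ⟨key.1, ?_⟩
  have hG := Gamma_ne_zero_of_re_pos hb
  have hk := key.2
  rw [hm] at hk
  -- The shift by 2w moves the argument of sine by wπ; this is the source of the sign (-1)^w.
  have hsin : sin (Real.pi * a / 2) = (-1) ^ w * sin (Real.pi * s / 4) := by
    rw [← Complex.sin_antiperiodic.sub_nat_mul_eq w, hadef]
    congr 1
    ring
  rw [hsin] at hk
  have hp : ((-1 : ℂ) ^ w)⁻¹ = (-1) ^ w := by
    rw [← inv_pow]; norm_num
  rw [← mul_right_inj' hG, hk]
  simp only [div_eq_mul_inv, mul_inv, hp]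
  field_simp

/-! ### Superpositions of dilates -/

/-- The Mellin transform of the superposition `x ↦ ∫ k τ * R (x * t τ)` of dilates of `R`. -/
theorem mellin_integral_dilate {T : Type*} [MeasurableSpace T] {ν : Measure T} [SFinite ν]
    {t : T → ℝ} {k : T → ℂ} {R : ℝ → ℂ} {z : ℂ} (htm : Measurable t) (hkm : Measurable k)
    (hR : Measurable R) (ht : ∀ᵐ τ ∂ν, 0 < t τ) (hz : MellinConvergent R z)
    (hk : Integrable (fun τ => k τ * (t τ : ℂ) ^ (-z)) ν) :
    MellinConvergent (fun x => ∫ τ, k τ * R (x * t τ) ∂ν) z ∧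
      mellin (fun x => ∫ τ, k τ * R (x * t τ) ∂ν) z =
        (∫ τ, k τ * (t τ : ℂ) ^ (-z) ∂ν) * mellin R z := by
  set G : ℝ × T → ℂ := fun p => (p.1 : ℂ) ^ (z - 1) * (k p.2 * R (p.1 * t p.2)) with hG
  have hGm : AEStronglyMeasurable G ((volume.restrict (Ioi (0 : ℝ))).prod ν) := by
    refine Measurable.aestronglyMeasurable ?_
    have h1 : Measurable fun p : ℝ × T => t p.2 := htm.comp measurable_snd
    have h2 : Measurable fun p : ℝ × T => k p.2 := hkm.comp measurable_snd
    have h3 : Measurable fun p : ℝ × T => R (p.1 * t p.2) := hR.comp (measurable_fst.mul h1)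
    fun_prop
  -- Rescaling x by t τ separates the variables, so `hk` and `hz` together give integrability on the
  -- product.
  have hnorm : ∀ τ, 0 < t τ → ∫ x in Ioi (0 : ℝ), ‖G (x, τ)‖ =
      ‖k τ * (t τ : ℂ) ^ (-z)‖ * ∫ x in Ioi (0 : ℝ), ‖(x : ℂ) ^ (z - 1) • R x‖ := by
    intro τ hτ
    have h := integral_comp_mul_left_Ioi (fun x : ℝ => ‖(x : ℂ) ^ (z - 1) • R x‖) 0 hτ
    rw [mul_zero] at h
    have h' : ∫ x in Ioi (0 : ℝ), ‖(x : ℂ) ^ (z - 1) • R x‖ =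
        t τ * ∫ x in Ioi (0 : ℝ), ‖((t τ * x : ℝ) : ℂ) ^ (z - 1) • R (t τ * x)‖ := by
      rw [h, smul_eq_mul, mul_inv_cancel_left₀ hτ.ne']
    rw [h', ← integral_const_mul, ← integral_const_mul]
    refine setIntegral_congr_fun measurableSet_Ioi fun x hx => ?_
    have hx := mem_Ioi.1 hx
    simp only [hG, norm_mul, norm_smul, Complex.norm_cpow_eq_rpow_re_of_pos hx,
      Complex.norm_cpow_eq_rpow_re_of_pos hτ,
      Complex.norm_cpow_eq_rpow_re_of_pos (mul_pos hτ hx), Real.mul_rpow hτ.le hx.le]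
    rw [neg_re, sub_re, one_re, Real.rpow_neg hτ.le, Real.rpow_sub hτ, Real.rpow_one,
      mul_comm x (t τ)]
    have : (t τ) ^ z.re ≠ 0 := (Real.rpow_pos_of_pos hτ _).ne'
    field_simp
  have hGi : Integrable G ((volume.restrict (Ioi (0 : ℝ))).prod ν) := by
    rw [integrable_prod_iff' hGm]
    constructor
    · filter_upwards [ht] with τ hτ
      have := ((MellinConvergent.comp_mul_left (f := R) (s := z) hτ).2 hz).const_mul (k τ)
      refine this.congr (Filter.Eventually.of_forall fun x => ?_)
      simp only [hG, smul_eq_mul, mul_comm x (t τ)]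
      ring
    · refine (hk.norm.mul_const (∫ x in Ioi (0 : ℝ), ‖(x : ℂ) ^ (z - 1) • R x‖)).congr ?_
      filter_upwards [ht] with τ hτ using (hnorm τ hτ).symm
  have e : ∀ x : ℝ, (x : ℂ) ^ (z - 1) • ∫ τ, k τ * R (x * t τ) ∂ν = ∫ τ, G (x, τ) ∂ν := by
    intro x
    rw [smul_eq_mul, ← integral_const_mul]
  constructor
  · have := hGi.integral_prod_left
    exact this.congr (Filter.Eventually.of_forall fun x => (e x).symm)
  · rw [mellin]
    simp only [e]
    rw [← integral_prod _ hGi, integral_prod_symm _ hGi, ← integral_mul_const]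
    refine integral_congr_ae ?_
    filter_upwards [ht] with τ hτ
    have := mellin_comp_mul_left R z hτ
    rw [mul_assoc, ← smul_eq_mul ((t τ : ℂ) ^ (-z)), ← this, mellin, ← integral_const_mul]
    refine integral_congr_ae (Filter.Eventually.of_forall fun x => ?_)
    simp only [hG, smul_eq_mul, mul_comm x (t τ)]
    ring

/-- The power series of a superposition of dilates. -/
theorem hasSum_integral_dilate {T : Type*} [MeasurableSpace T] {ν : Measure T}
    {t k : T → ℝ} {R : ℝ → ℝ} {a : ℕ → ℝ} {e : ℕ → ℕ} {C : ℝ}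
    (hR : ∀ x, 0 ≤ x → HasSum (fun j => a j * x ^ e j) (R x)) (ht : ∀ᵐ τ ∂ν, 0 < t τ)
    (hk : ∀ j, Integrable (fun τ => k τ * t τ ^ e j) ν)
    (hC : ∀ j, ∫ τ, ‖k τ * t τ ^ e j‖ ∂ν ≤ C) {x : ℝ} (hx : 0 ≤ x) :
    HasSum (fun j => a j * x ^ e j * ∫ τ, k τ * t τ ^ e j ∂ν) (∫ τ, k τ * R (x * t τ) ∂ν) := by
  -- The uniform bound C on the absolute moments leaves C times the absolutely convergent series of
  -- R at x, which permits exchanging sum and integral.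
  have hsum : Summable fun j => ∫ τ, ‖a j * x ^ e j * (k τ * t τ ^ e j)‖ ∂ν := by
    simp only [norm_mul _ (k _ * _), integral_const_mul]
    exact Summable.of_nonneg_of_le (fun j => by positivity)
      (fun j => mul_le_mul_of_nonneg_left (hC j) (norm_nonneg _)) ((hR x hx).summable.norm.mul_right C)
  have h := hasSum_integral_of_summable_integral_norm (fun j => (hk j).const_mul _) hsum
  simp only [integral_const_mul] at h
  refine (integral_congr_ae ?_ : ∫ τ, k τ * R (x * t τ) ∂ν =
    ∫ τ, ∑' j, a j * x ^ e j * (k τ * t τ ^ e j) ∂ν) ▸ h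
  filter_upwards [ht] with τ hτ
  have := (hR (x * t τ) (mul_nonneg hx hτ.le)).mul_left (k τ)
  rw [← this.tsum_eq]
  refine tsum_congr fun j => ?_
  rw [mul_pow]; ring

/-! ### The dilation kernel and its moments -/

/-- The parameter space of the dilations: `(v, u) ∈ (0,1)²` and `j ∈ ℕ`. -/
def dilMeasure : Measure ((ℝ × ℝ) × ℕ) :=
  ((volume.restrict (Ioo 0 1)).prod (volume.restrict (Ioo 0 1))).prod Measure.count

/-- The dilation factor `v u / (j+1)²`. -/
def dilScale (τ : (ℝ × ℝ) × ℕ) : ℝ := τ.1.1 * τ.1.2 * (((τ.2 + 1 : ℕ) : ℝ) ^ 2)⁻¹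

/-- The weight `v^{-5/4} (1-u)^{-3/4} μ(j+1) (j+1)^{-1/2}`. -/
def dilWeight (τ : (ℝ × ℝ) × ℕ) : ℝ :=
  τ.1.1 ^ (-(5 / 4) : ℝ) * (1 - τ.1.2) ^ (-(3 / 4) : ℝ) *
    (ArithmeticFunction.moebius (τ.2 + 1) * ((τ.2 + 1 : ℕ) : ℝ) ^ (-(1 / 2) : ℝ))

instance : SFinite dilMeasure := by unfold dilMeasure; infer_instance

theorem measurable_dilScale : Measurable dilScale := by
  unfold dilScale
  have : Measurable fun τ : (ℝ × ℝ) × ℕ => ((τ.2 + 1 : ℕ) : ℝ) :=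
    (measurable_from_nat (f := fun n : ℕ => ((n + 1 : ℕ) : ℝ))).comp measurable_snd
  fun_prop

theorem measurable_dilWeight : Measurable dilWeight := by
  unfold dilWeight
  have : Measurable fun τ : (ℝ × ℝ) × ℕ =>
      ((ArithmeticFunction.moebius (τ.2 + 1) : ℤ) : ℝ) * ((τ.2 + 1 : ℕ) : ℝ) ^ (-(1 / 2) : ℝ) :=
    (measurable_from_nat (f := fun n : ℕ =>
      ((ArithmeticFunction.moebius (n + 1) : ℤ) : ℝ) * ((n + 1 : ℕ) : ℝ) ^ (-(1 / 2) : ℝ))).comp measurable_snd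
  fun_prop

theorem ae_dilMeasure : ∀ᵐ τ ∂dilMeasure, (0 < τ.1.1 ∧ τ.1.1 < 1) ∧ 0 < τ.1.2 ∧ τ.1.2 < 1 := by
  unfold dilMeasure
  have h : ∀ᵐ p ∂((volume.restrict (Ioo (0 : ℝ) 1)).prod (volume.restrict (Ioo (0 : ℝ) 1))),
      (0 < p.1 ∧ p.1 < 1) ∧ 0 < p.2 ∧ p.2 < 1 := by
    rw [Measure.prod_restrict]
    filter_upwards [ae_restrict_mem (measurableSet_Ioo.prod measurableSet_Ioo)] with p hp
    exact hp
  exact Measure.quasiMeasurePreserving_fst.ae h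

theorem dilScale_pos : ∀ᵐ τ ∂dilMeasure, 0 < dilScale τ := by
  filter_upwards [ae_dilMeasure] with τ hτ
  have := hτ.1.1
  have := hτ.2.1
  unfold dilScale
  positivity

theorem dilScale_le_one : ∀ᵐ τ ∂dilMeasure, dilScale τ ≤ 1 := by
  filter_upwards [ae_dilMeasure] with τ hτ
  unfold dilScale
  have h2 : (((τ.2 + 1 : ℕ) : ℝ) ^ 2)⁻¹ ≤ 1 := by
    refine inv_le_one_of_one_le₀ ?_
    push_cast
    nlinarith [(τ.2.cast_nonneg : (0 : ℝ) ≤ τ.2)]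
  have h3 := hτ.1.1
  have h4 := hτ.2.1
  have : τ.1.1 * τ.1.2 ≤ 1 := mul_le_one₀ hτ.1.2.le h4.le hτ.2.2.le
  exact mul_le_one₀ this (by positivity) h2

theorem summable_moebius {s : ℂ} (hs : 1 / 2 < s.re) :
    Summable (fun j : ℕ => ((ArithmeticFunction.moebius (j + 1) : ℤ) : ℂ) *
      ((j + 1 : ℕ) : ℂ) ^ (-(1 / 2 + s))) ∧
    ∑' j : ℕ, ((ArithmeticFunction.moebius (j + 1) : ℤ) : ℂ) *
      ((j + 1 : ℕ) : ℂ) ^ (-(1 / 2 + s)) = (riemannZeta (1 / 2 + s))⁻¹ := by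
  have h1 : 1 < (1 / 2 + s).re := by
    rw [add_re]
    have : ((1 / 2 : ℂ)).re = 1 / 2 := by norm_num
    linarith
  have hS := (ArithmeticFunction.LSeriesSummable_moebius_iff (s := 1 / 2 + s)).2 h1
  have hE := ArithmeticFunction.LSeries_zeta_mul_Lseries_moebius h1
  rw [ArithmeticFunction.LSeries_zeta_eq_riemannZeta h1] at hE
  have e : ∀ j : ℕ, LSeries.term (fun n => ((ArithmeticFunction.moebius n : ℤ) : ℂ)) (1 / 2 + s) (j + 1)
      = ((ArithmeticFunction.moebius (j + 1) : ℤ) : ℂ) * ((j + 1 : ℕ) : ℂ) ^ (-(1 / 2 + s)) := by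
    intro j
    rw [LSeries.term_of_ne_zero (Nat.succ_ne_zero j), Complex.cpow_neg, div_eq_mul_inv]
  have hS' := (summable_nat_add_iff 1).2 hS
  simp only [e] at hS'
  refine ⟨hS', ?_⟩
  rw [LSeries, hS.tsum_eq_zero_add, LSeries.term_zero, zero_add] at hE
  simp only [e] at hE
  exact eq_inv_of_mul_eq_one_right hE

theorem integral_cpow_unitInterval {b : ℂ} (hb : -1 < b.re) :
    IntegrableOn (fun v : ℝ => (v : ℂ) ^ b) (Ioo 0 1) ∧
      ∫ v in Ioo (0 : ℝ) 1, (v : ℂ) ^ b = 1 / (b + 1) := by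
  have h1 : IntervalIntegrable (fun v : ℝ => (v : ℂ) ^ b) volume 0 1 :=
    intervalIntegral.intervalIntegrable_cpow' hb
  have hb1 : b + 1 ≠ 0 := fun h => by
    have := congrArg Complex.re h
    simp at this
    linarith
  refine ⟨((intervalIntegrable_iff_integrableOn_Ioo_of_le zero_le_one).1 h1), ?_⟩
  rw [← integral_Ioc_eq_integral_Ioo, ← intervalIntegral.integral_of_le zero_le_one,
    integral_cpow (Or.inl hb)]
  simp [Complex.zero_cpow hb1]

theorem integral_beta_unitInterval {a b : ℂ} (ha : 0 < a.re) (hb : 0 < b.re) :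
    IntegrableOn (fun v : ℝ => (v : ℂ) ^ (a - 1) * (1 - (v : ℂ)) ^ (b - 1)) (Ioo 0 1) ∧
      ∫ v in Ioo (0 : ℝ) 1, (v : ℂ) ^ (a - 1) * (1 - (v : ℂ)) ^ (b - 1) =
        Gamma a * Gamma b / Gamma (a + b) := by
  have h1 := betaIntegral_convergent ha hb
  refine ⟨((intervalIntegrable_iff_integrableOn_Ioo_of_le zero_le_one).1 h1), ?_⟩
  rw [← integral_Ioc_eq_integral_Ioo, ← intervalIntegral.integral_of_le zero_le_one,
    Gamma_mul_Gamma_eq_betaIntegral ha hb, mul_div_cancel_left₀]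
  · rfl
  · exact Gamma_ne_zero_of_re_pos (by rw [add_re]; positivity)

theorem ofReal_cpow_eq_exp {x : ℝ} (hx : 0 < x) (z : ℂ) :
    (x : ℂ) ^ z = exp ((Real.log x : ℝ) * z) := by
  rw [Complex.cpow_def_of_ne_zero (by exact_mod_cast hx.ne'), Complex.ofReal_log hx.le]

/-- The moments of the dilation kernel, through the Beta integral and `1/ζ = ∑ μ(m) m^{-s}`. -/
theorem dilMoment {s : ℂ} (hs : 1 / 2 < s.re) :
    Integrable (fun τ => (dilWeight τ : ℂ) * (dilScale τ : ℂ) ^ (s / 2)) dilMeasure ∧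
    ∫ τ, (dilWeight τ : ℂ) * (dilScale τ : ℂ) ^ (s / 2) ∂dilMeasure =
      1 / (s / 2 - 1 / 4) * (Gamma (1 + s / 2) * Gamma (1 / 4) / Gamma (5 / 4 + s / 2)) *
        (riemannZeta (1 / 2 + s))⁻¹ := by
  have hsr : (s / 2).re = s.re / 2 := by simp
  have h54 : (5 / 4 : ℂ).re = 5 / 4 := by norm_num
  have h14 : (1 / 4 : ℂ).re = 1 / 4 := by norm_num
  obtain ⟨i1, v1⟩ := integral_cpow_unitInterval (b := s / 2 - 5 / 4)
    (by rw [sub_re, hsr, h54]; linarith)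
  obtain ⟨i2, v2⟩ := integral_beta_unitInterval (a := 1 + s / 2) (b := 1 / 4)
    (by rw [add_re, hsr, one_re]; linarith) (by rw [h14]; norm_num)
  obtain ⟨i3, v3⟩ := summable_moebius hs
  have i3' : Integrable (fun j : ℕ => ((ArithmeticFunction.moebius (j + 1) : ℤ) : ℂ) *
      ((j + 1 : ℕ) : ℂ) ^ (-(1 / 2 + s))) Measure.count := by
    rw [integrable_count_iff]; exact i3.norm
  have hI := (Integrable.mul_prod i1 i2).mul_prod i3'
  have hae : (fun τ : (ℝ × ℝ) × ℕ => ((τ.1.1 : ℂ) ^ (s / 2 - 5 / 4) *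
      ((τ.1.2 : ℂ) ^ (1 + s / 2 - 1) * (1 - (τ.1.2 : ℂ)) ^ (1 / 4 - 1 : ℂ))) *
      (((ArithmeticFunction.moebius (τ.2 + 1) : ℤ) : ℂ) * ((τ.2 + 1 : ℕ) : ℂ) ^ (-(1 / 2 + s))))
      =ᵐ[dilMeasure] fun τ => (dilWeight τ : ℂ) * (dilScale τ : ℂ) ^ (s / 2) := by
    filter_upwards [ae_dilMeasure] with τ hτ
    obtain ⟨⟨hv, hv1⟩, hu, hu1⟩ := hτ
    have hj : (0 : ℝ) < ((τ.2 + 1 : ℕ) : ℝ) := by positivity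
    unfold dilWeight dilScale
    rw [← Complex.ofReal_natCast]
    generalize ((τ.2 + 1 : ℕ) : ℝ) = J at hj
    rw [ofReal_cpow_eq_exp hv, ofReal_cpow_eq_exp hu,
      ofReal_cpow_eq_exp hj, ← Complex.ofReal_one, ← Complex.ofReal_sub,
      ofReal_cpow_eq_exp (sub_pos.2 hu1),
      ofReal_cpow_eq_exp (x := τ.1.1 * τ.1.2 * (J ^ 2)⁻¹) (by positivity), Complex.ofReal_mul, Complex.ofReal_mul,
      Complex.ofReal_mul, Complex.ofReal_cpow hv.le, Complex.ofReal_cpow (sub_pos.2 hu1).le,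
      Complex.ofReal_cpow hj.le, ofReal_cpow_eq_exp hv, ofReal_cpow_eq_exp hj,
      ofReal_cpow_eq_exp (sub_pos.2 hu1), Real.log_mul (by positivity) (by positivity),
      Real.log_mul hv.ne' hu.ne', Real.log_inv, Real.log_pow]
    -- With every power written as an exponential of a logarithm, the identity is an equality of
    -- exponents; the Möbius value M stays a spectator.
    have key : ∀ A B C D A' C' D' E M : ℂ, A + (B + C) + D = A' + C' + D' + E →
        exp A * (exp B * exp C) * (M * exp D) = exp A' * exp C' * (M * exp D') * exp E := by
      intro A B C D A' C' D' E M h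
      have := congrArg exp h
      simp only [Complex.exp_add] at this
      linear_combination M * this
    rw [Complex.ofReal_intCast]
    refine key _ _ _ _ _ _ _ _ _ ?_
    push_cast
    ring
  refine ⟨hI.congr hae, ?_⟩
  rw [← integral_congr_ae hae, dilMeasure]
  rw [integral_prod_mul (fun p : ℝ × ℝ => (p.1 : ℂ) ^ (s / 2 - 5 / 4) *
      ((p.2 : ℂ) ^ (1 + s / 2 - 1) * (1 - (p.2 : ℂ)) ^ (1 / 4 - 1 : ℂ)))
      (fun j : ℕ => ((ArithmeticFunction.moebius (j + 1) : ℤ) : ℂ) *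
        ((j + 1 : ℕ) : ℂ) ^ (-(1 / 2 + s))),
    integral_prod_mul (fun v : ℝ => (v : ℂ) ^ (s / 2 - 5 / 4))
      (fun u : ℝ => (u : ℂ) ^ (1 + s / 2 - 1) * (1 - (u : ℂ)) ^ (1 / 4 - 1 : ℂ)), v1, v2,
    integral_countable i3']
  simp only [Measure.real, Measure.count_singleton, ENNReal.toReal_one, one_smul, v3]
  congr 3
  · ring
  · congr 1; ring

theorem dilMoment_four_mul {k : ℕ} (hk : 1 ≤ k) :
    Integrable (fun τ => dilWeight τ * dilScale τ ^ (2 * k)) dilMeasure ∧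
    ((∫ τ, dilWeight τ * dilScale τ ^ (2 * k) ∂dilMeasure : ℝ) : ℂ) =
      1 / (2 * k - 1 / 4) * (Gamma (1 + 2 * k) * Gamma (1 / 4) / Gamma (5 / 4 + 2 * k)) *
        (riemannZeta (1 / 2 + 4 * k))⁻¹ := by
  have hk' : (1 : ℝ) ≤ k := by exact_mod_cast hk
  have h := dilMoment (s := 4 * k) (by simp; linarith)
  have e : (4 * k / 2 : ℂ) = ((2 * k : ℕ) : ℂ) := by push_cast; ring
  simp only [e, Complex.cpow_natCast] at h
  have e2 : ∀ τ, (dilWeight τ : ℂ) * (dilScale τ : ℂ) ^ (2 * k) =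
      ((dilWeight τ * dilScale τ ^ (2 * k) : ℝ) : ℂ) := fun τ => by push_cast; rfl
  simp only [e2] at h
  refine ⟨h.1.re, ?_⟩
  rw [← integral_complex_ofReal, h.2]
  push_cast
  rfl

/-- The scale lies in (0,1] almost everywhere, so the absolute moments decrease in k and the first
bounds them all. -/
theorem integral_norm_dilWeight_le {k : ℕ} (hk : 1 ≤ k) :
    ∫ τ, ‖dilWeight τ * dilScale τ ^ (2 * k)‖ ∂dilMeasure ≤
      ∫ τ, ‖dilWeight τ * dilScale τ ^ (2 * 1)‖ ∂dilMeasure := by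
  refine integral_mono_ae (dilMoment_four_mul hk).1.norm (dilMoment_four_mul le_rfl).1.norm ?_
  filter_upwards [dilScale_pos, dilScale_le_one] with τ h0 h1
  simp only [norm_mul]
  refine mul_le_mul_of_nonneg_left ?_ (norm_nonneg _)
  rw [Real.norm_of_nonneg (by positivity), Real.norm_of_nonneg (by positivity)]
  exact pow_le_pow_of_le_one h0.le h1 (by omega)

/-! ### The coefficients `ctilde` and the power series of `P0` and `P` -/

/-- The constant `1 / (π^{3/4} Γ(1/4))`. -/
def dilConst : ℝ := 1 / (Real.pi ^ (3 / 4 : ℝ) * Real.Gamma (1 / 4))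

theorem dilConst_pos : 0 < dilConst := by
  have := Real.Gamma_pos_of_pos (s := 1 / 4) (by norm_num)
  unfold dilConst
  positivity

theorem ofReal_dilConst :
    (dilConst : ℂ) = 1 / (((Real.pi ^ (3 / 4 : ℝ) : ℝ) : ℂ) * Gamma (1 / 4)) := by
  rw [dilConst, Complex.ofReal_div, Complex.ofReal_mul, ← Complex.Gamma_ofReal]
  norm_num

/-- In the moment at s = 4k the factor Γ(1 + 2k) is (2k)! and Γ(1/4) cancels against `dilConst`. In
particular the coefficient is real. -/
theorem ctilde_eq {k : ℕ} (hk : 1 ≤ k) : ctilde k =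
    ((dilConst * (∫ τ, dilWeight τ * dilScale τ ^ (2 * k) ∂dilMeasure) / (2 * k).factorial : ℝ) : ℂ) := by
  rw [Complex.ofReal_div, Complex.ofReal_mul, (dilMoment_four_mul hk).2, ofReal_dilConst, ctilde]
  have h1 : Gamma (1 + 2 * k) = ((2 * k).factorial : ℂ) := by
    rw [← Complex.Gamma_nat_eq_factorial]; push_cast; ring_nf
  rw [h1]
  have h2 : ((2 * k).factorial : ℂ) ≠ 0 := by exact_mod_cast Nat.factorial_ne_zero _
  have h3 : Gamma (1 / 4) ≠ 0 := Gamma_ne_zero_of_re_pos (by norm_num)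
  rw [Complex.ofReal_natCast]
  simp only [div_eq_mul_inv, mul_inv, one_mul]
  field_simp

theorem ctilde_bound : ∃ C, 0 ≤ C ∧ ∀ k : ℕ, 1 ≤ k → ‖ctilde k‖ ≤ C / (2 * k).factorial := by
  refine ⟨dilConst * ∫ τ, ‖dilWeight τ * dilScale τ ^ (2 * 1)‖ ∂dilMeasure,
    mul_nonneg dilConst_pos.le (integral_nonneg fun _ => norm_nonneg _), fun k hk => ?_⟩
  rw [ctilde_eq hk, Complex.norm_real, norm_div, norm_mul, Real.norm_of_nonneg dilConst_pos.le,
    Real.norm_natCast]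
  have := dilConst_pos
  gcongr
  exact (norm_integral_le_integral_norm _).trans (integral_norm_dilWeight_le hk)

theorem summable_ctilde_mul_pow (r : ℝ) :
    Summable fun k : ℕ => ‖ctilde (k + 1)‖ * (r ^ 2) ^ (k + 1) := by
  obtain ⟨C, hC, h⟩ := ctilde_bound
  have h1 : Summable fun k : ℕ => C * (r ^ (2 * (k + 1)) / (2 * (k + 1)).factorial) := by
    refine Summable.mul_left C ?_
    exact (Real.summable_pow_div_factorial r).comp_injective
      (i := fun k : ℕ => 2 * (k + 1)) fun a b hab => by simpa using hab
  refine Summable.of_nonneg_of_le (fun k => by positivity) (fun k => ?_) h1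
  rw [pow_mul]
  calc _ ≤ C / (2 * (k + 1)).factorial * (r ^ 2) ^ (k + 1) := by
        gcongr; exact h (k + 1) (by omega)
    _ = _ := by ring

theorem Gamma_add_nat_eq_poch {z : ℂ} (hz : 0 < z.re) (m : ℕ) :
    Gamma (z + m) = Gamma z * poch z m := by
  induction m with
  | zero => simp [poch]
  | succ m ih =>
    have : z + m ≠ 0 := fun h => by
      have := congrArg Complex.re h
      simp at this
      have h2 : (0 : ℝ) ≤ m := m.cast_nonneg
      linarith
    rw [Nat.cast_succ, ← add_assoc, Gamma_add_one _ this, ih, poch, poch, Finset.prod_range_succ]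
    ring

/-- The prefactor 4/Γ(1/4) is 1/Γ(5/4), which the Pochhammer symbol raises to 1/Γ(5/4 + 2k). -/
theorem P0Term_eq (z : ℂ) (k : ℕ) : P0Term z k = -(ctilde k * (-z ^ 2) ^ k) := by
  have h := Gamma_add_nat_eq_poch (z := 5 / 4) (by norm_num) (2 * k)
  have h54 : Gamma (5 / 4) = 1 / 4 * Gamma (1 / 4) := by
    rw [← Gamma_add_one _ (by norm_num)]; norm_num
  push_cast at h
  rw [P0Term, ctilde, h, h54]
  simp only [div_eq_mul_inv, mul_inv, one_mul, inv_inv]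
  ring

theorem norm_P0Term_le {z : ℂ} {r : ℝ} (hz : ‖z‖ ≤ r) (k : ℕ) :
    ‖P0Term z (k + 1)‖ ≤ ‖ctilde (k + 1)‖ * (r ^ 2) ^ (k + 1) := by
  rw [P0Term_eq, norm_neg, norm_mul, norm_pow, norm_neg, norm_pow]
  gcongr

theorem summable_P0Term (z : ℂ) : Summable fun k : ℕ => P0Term z (k + 1) :=
  Summable.of_norm_bounded (summable_ctilde_mul_pow ‖z‖)
    fun k => norm_P0Term_le le_rfl k

theorem differentiable_P0 : Differentiable ℂ P0 := by
  intro z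
  have h : DifferentiableOn ℂ P0 (Metric.ball 0 (‖z‖ + 1)) := by
    refine differentiableOn_tsum_of_summable_norm
      (summable_ctilde_mul_pow (‖z‖ + 1)) (fun k => ?_)
      Metric.isOpen_ball fun k y hy => norm_P0Term_le (mem_ball_zero_iff.1 hy).le k
    simp only [P0Term_eq]
    fun_prop
  exact h.differentiableAt (Metric.isOpen_ball.mem_nhds (by simp))

theorem P0_neg (z : ℂ) : P0 (-z) = P0 z := by simp [P0, P0Term]

theorem differentiable_P (w : ℕ) : Differentiable ℂ (P w) := by
  have := differentiable_P0
  unfold P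
  fun_prop

theorem P_zero : P 0 = P0 := by ext z; simp [P]

theorem hasSum_P (w : ℕ) (z : ℂ) :
    HasSum (fun k : ℕ => (-1) ^ (w + 1) * (ctilde (w + 1 + k) * (-z ^ 2) ^ (w + 1 + k))) (P w z) := by
  have h := (hasSum_nat_add_iff' w).2 (summable_P0Term z).hasSum
  have h2 := h.mul_left ((-1) ^ w)
  have e : ∑ i ∈ Finset.range w, P0Term z (i + 1) =
      -∑ k ∈ Finset.Icc 1 w, ctilde k * (-z ^ 2) ^ k := by
    rw [← Finset.sum_neg_distrib, Finset.range_eq_Ico,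
      Finset.sum_Ico_add' (fun k => P0Term z k) 0 w 1]
    refine Finset.sum_congr ?_ fun k _ => P0Term_eq z k
    ext k; simp
  rw [e, sub_neg_eq_add] at h2
  refine h2.congr_fun fun k => ?_
  rw [P0Term_eq, show k + w + 1 = w + 1 + k by ring]
  ring

/-- `P_{4w}` on the positive axis, as a superposition of dilates of `cosRem w`. -/
theorem P_ofReal (w : ℕ) {x : ℝ} (hx : 0 ≤ x) :
    P w (x : ℂ) =
      ((dilConst * ∫ τ, dilWeight τ * cosRem w (x * dilScale τ) ∂dilMeasure : ℝ) : ℂ) := by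
  have h := hasSum_integral_dilate (ν := dilMeasure) (t := dilScale) (k := dilWeight)
    (R := cosRem w) (a := fun j => (-1) ^ j / ((2 * (w + 1 + j)).factorial : ℝ))
    (e := fun j => 2 * (w + 1 + j)) (fun x _ => ?_) dilScale_pos
    (fun j => (dilMoment_four_mul (by omega)).1)
    (fun j => integral_norm_dilWeight_le (by omega)) hx
  · refine (hasSum_P w x).unique ((Complex.hasSum_ofReal.2 (h.mul_left dilConst)).congr_fun
      fun j => ?_)
    rw [ctilde_eq (by omega)]
    generalize ∫ τ, dilWeight τ * dilScale τ ^ (2 * (w + 1 + j)) ∂dilMeasure = M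
    push_cast
    rw [neg_pow ((x : ℂ) ^ 2), ← pow_mul, pow_add (-1 : ℂ) (w + 1) j]
    -- The prefactor (-1)^(w+1) of `hasSum_P` absorbs the same sign inside (-x²)^(w+1+j), leaving
    -- the (-1)^j of `hasSum_cosRem`.
    have : ((-1 : ℂ) ^ (w + 1)) * (-1) ^ (w + 1) = 1 := by rw [← mul_pow]; norm_num
    linear_combination (dilConst * M / ((2 * (w + 1 + j)).factorial : ℂ) * (-1) ^ j *
      (x : ℂ) ^ (2 * (w + 1 + j))) * this
  · refine (hasSum_cosRem w x).congr_fun fun j => ?_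
    ring

/-! ### From Mellin transforms to two-sided Laplace integrals -/

/-- The substitution x = π e^{-2y}: then |dx| = 2x dy and x^(-s/2) = π^(-s/2) e^{sy}, which accounts
for the factor π^(s/2)/2. -/
theorem integral_exp_comp_of_mellin {g : ℝ → ℂ} {s : ℂ} (h : MellinConvergent g (-s / 2)) :
    Integrable (fun y : ℝ => exp (s * y) * g (Real.pi * Real.exp (-2 * y))) ∧
      ∫ y : ℝ, exp (s * y) * g (Real.pi * Real.exp (-2 * y)) =
        (Real.pi : ℂ) ^ (s / 2) / 2 * mellin g (-s / 2) := by
  set φ : ℝ → ℝ := fun y => Real.pi * Real.exp (-2 * y) with hφ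
  have hpos : ∀ y, 0 < φ y := fun y => mul_pos Real.pi_pos (Real.exp_pos _)
  have hd : ∀ y ∈ (univ : Set ℝ), HasDerivWithinAt φ (-2 * φ y) univ y := by
    intro y _
    have h1 := ((((hasDerivAt_id y).const_mul (-2)).exp).const_mul Real.pi).hasDerivWithinAt
      (s := univ)
    refine h1.congr_deriv ?_
    simp only [hφ, id_eq]; ring
  have hinj : InjOn φ univ := by
    intro x _ y _ hxy
    have := Real.exp_injective (mul_left_cancel₀ Real.pi_ne_zero hxy)
    linarith
  have him : φ '' univ = Ioi 0 := by
    ext x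
    simp only [image_univ, mem_range, mem_Ioi]
    refine ⟨fun ⟨y, hy⟩ => hy ▸ hpos y, fun hx => ⟨-(Real.log (x / Real.pi)) / 2, ?_⟩⟩
    simp only [hφ]
    rw [show -2 * (-(Real.log (x / Real.pi)) / 2) = Real.log (x / Real.pi) by ring,
      Real.exp_log (div_pos hx Real.pi_pos), mul_div_cancel₀ _ Real.pi_ne_zero]
  have hpi : (Real.pi : ℂ) ^ (s / 2) ≠ 0 := by
    rw [ofReal_cpow_eq_exp Real.pi_pos]; exact Complex.exp_ne_zero _
  have e : ∀ y : ℝ, |-2 * φ y| • ((φ y : ℂ) ^ (-s / 2 - 1) • g (φ y)) =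
      (2 / (Real.pi : ℂ) ^ (s / 2)) * (exp (s * y) * g (φ y)) := by
    intro y
    have h1 : |-2 * φ y| = 2 * φ y := by
      rw [abs_mul, abs_of_pos (hpos y)]; norm_num
    have h2 : (φ y : ℂ) * (φ y : ℂ) ^ (-s / 2 - 1) = exp (s * y) / (Real.pi : ℂ) ^ (s / 2) := by
      have h0 : (φ y : ℂ) ≠ 0 := by exact_mod_cast (hpos y).ne'
      rw [Complex.cpow_sub _ _ h0, Complex.cpow_one, mul_div_cancel₀ _ h0,
        ofReal_cpow_eq_exp (hpos y), ofReal_cpow_eq_exp Real.pi_pos, ← Complex.exp_sub]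
      simp only [hφ]
      rw [Real.log_mul Real.pi_ne_zero (Real.exp_pos _).ne', Real.log_exp]
      congr 1
      push_cast
      ring
    rw [h1, Complex.real_smul, smul_eq_mul]
    push_cast
    linear_combination (2 * g (φ y)) * h2
  have hi := (integrableOn_image_iff_integrableOn_abs_deriv_smul MeasurableSet.univ hd hinj
    (fun x : ℝ => (x : ℂ) ^ (-s / 2 - 1) • g x))
  have hv := integral_image_eq_integral_abs_deriv_smul MeasurableSet.univ hd hinj
    (fun x : ℝ => (x : ℂ) ^ (-s / 2 - 1) • g x)
  simp only [e, him, integrableOn_univ, setIntegral_univ] at hi hv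
  have hi' := (hi.1 h).const_mul ((Real.pi : ℂ) ^ (s / 2) / 2)
  have hone : (Real.pi : ℂ) ^ (s / 2) / 2 * (2 / (Real.pi : ℂ) ^ (s / 2)) = 1 := by field_simp
  constructor
  · simpa only [← mul_assoc, hone, one_mul] using hi'
  · rw [mellin, hv, integral_const_mul, ← mul_assoc, hone, one_mul]

theorem two_mul_xi_half_add {s : ℂ} (hs : 1 / 2 < s.re) : 2 * xi (1 / 2 + s) =
    (Real.pi : ℂ) ^ (-(1 / 2 + s) / 2) * (2 * Gamma (5 / 4 + s / 2)) * (s - 1 / 2) *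
      riemannZeta (1 / 2 + s) := by
  rw [xi_eq, a, l]
  · rw [show 1 + (1 / 2 + s) / 2 = 5 / 4 + s / 2 by ring, show 1 / 2 + s - 1 = s - 1 / 2 by ring]
    ring
  · intro h
    have := congrArg Complex.re h
    simp at this
    norm_num at this
    linarith
  · intro m h
    have := congrArg Complex.re h
    simp at this
    norm_num at this
    have h2 : (0 : ℝ) ≤ m := m.cast_nonneg
    linarith

/-- The Mellin transform is the moment at s/2 times that of `cosRem w`. The factor Γ(1 + s/2)
cancels between them, and what remains is the reciprocal of sin(πs/4) · 2ξ(1/2 + s). The condition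
Re s > 1/2, needed by the moment, is a separate restriction only for w = 0. -/
theorem laplace_P (w : ℕ) {s : ℂ} (hs : 1 / 2 < s.re) (h1 : 4 * w < s.re) (h2 : s.re < 4 * w + 4) :
    Integrable (laplaceIntegrand (P w) s) ∧
      ∫ y : ℝ, laplaceIntegrand (P w) s y = (-1) ^ w * f s := by
  obtain ⟨hc, hm⟩ := mellin_cosRem w h1 h2
  obtain ⟨hk, hv⟩ := dilMoment hs
  have hneg : -(-s / 2) = s / 2 := by ring
  obtain ⟨hc2, hm2⟩ := mellin_integral_dilate measurable_dilScale
    (Complex.measurable_ofReal.comp measurable_dilWeight)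
    (Complex.measurable_ofReal.comp (continuous_cosRem w).measurable) dilScale_pos hc
    (by rw [hneg]; exact hk)
  obtain ⟨hi, he⟩ := integral_exp_comp_of_mellin hc2
  have e : laplaceIntegrand (P w) s = fun y : ℝ => (dilConst : ℂ) * (exp (s * y) *
      (fun x : ℝ => ∫ τ, (Complex.ofReal ∘ dilWeight) τ *
        (Complex.ofReal ∘ cosRem w) (x * dilScale τ) ∂dilMeasure) (Real.pi * Real.exp (-2 * y))) := by
    ext y
    rw [laplaceIntegrand, P_ofReal w (by positivity), Complex.ofReal_mul, ← integral_complex_ofReal]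
    simp only [Function.comp_apply, Complex.ofReal_mul]
    ring
  rw [e]
  refine ⟨hi.const_mul _, ?_⟩
  rw [integral_const_mul, he, hm2, hneg]
  simp only [Function.comp_def]
  rw [hv, hm, f, n, two_mul_xi_half_add hs, ofReal_dilConst]
  have hG : Gamma (1 + s / 2) ≠ 0 := Gamma_ne_zero_of_re_pos (by
    rw [add_re, one_re, show (s / 2).re = s.re / 2 by simp]; linarith)
  have hG4 : Gamma (1 / 4) ≠ 0 := Gamma_ne_zero_of_re_pos (by norm_num)
  have hL : (Real.pi : ℂ) = exp (Real.log Real.pi : ℝ) := by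
    rw [← Complex.ofReal_exp, Real.exp_log Real.pi_pos]
  rw [Complex.ofReal_cpow Real.pi_pos.le, ofReal_cpow_eq_exp Real.pi_pos,
    ofReal_cpow_eq_exp Real.pi_pos, ofReal_cpow_eq_exp Real.pi_pos]
  generalize (Real.log Real.pi : ℝ) = L at hL
  have hexp : (exp (L * ((3 / 4 : ℝ) : ℂ)))⁻¹ * exp (L * (s / 2)) * exp L =
      (exp (L * (-(1 / 2 + s) / 2)))⁻¹ := by
    rw [← Complex.exp_neg, ← Complex.exp_neg, ← Complex.exp_add, ← Complex.exp_add]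
    congr 1
    push_cast
    ring
  have hpi : ∀ S : ℂ, (Real.pi : ℂ) / S = exp L / S := fun S => by rw [hL]
  rw [hpi, show s / 2 - 1 / 4 = (s - 1 / 2) * 2⁻¹ by ring]
  generalize s - 1 / 2 = D, Gamma (1 + s / 2) = G₁ at hG ⊢
  generalize Gamma (1 / 4) = G₂ at hG4 ⊢
  generalize Gamma (5 / 4 + s / 2) = G₃, riemannZeta (1 / 2 + s) = Z, sin (Real.pi * s / 4) = S
  simp only [div_eq_mul_inv, mul_inv, one_mul, inv_inv] at hexp hG hG4 ⊢
  rw [← hexp]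
  field_simp

/-! ### Positivity for w ≥ 1 -/

theorem moebius_cosRem_pos (w : ℕ) {y : ℝ} (hy : 0 < y) :
    0 < ∑' j : ℕ, ((ArithmeticFunction.moebius (j + 1) : ℤ) : ℝ) * ((j + 1 : ℕ) : ℝ) ^ (-(1 / 2) : ℝ) *
      cosRem (w + 1) (y * (((j + 1 : ℕ) : ℝ) ^ 2)⁻¹) := by
  set R := cosRem (w + 1) y with hRdef
  have hR : 0 < R := (sinRem_pos_and_cosRem_pos w).2 y hy
  set T : ℕ → ℝ := fun j => ((ArithmeticFunction.moebius (j + 1) : ℤ) : ℝ) *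
    ((j + 1 : ℕ) : ℝ) ^ (-(1 / 2) : ℝ) * cosRem (w + 1) (y * (((j + 1 : ℕ) : ℝ) ^ 2)⁻¹) with hT
  have hz : HasSum (fun j : ℕ => 1 / (((j + 1 : ℕ) : ℝ) ^ 2)) (Real.pi ^ 2 / 6) := by
    have := (hasSum_nat_add_iff' 1).2 hasSum_zeta_two
    simpa using this
  have hb : ∀ j, |T j| ≤ R * (1 / ((j + 1 : ℕ) : ℝ) ^ 2) := by
    intro j
    have hj : (1 : ℝ) ≤ ((j + 1 : ℕ) : ℝ) := by push_cast; linarith [(j.cast_nonneg : (0 : ℝ) ≤ j)]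
    have hi1 : (((j + 1 : ℕ) : ℝ) ^ 2)⁻¹ ≤ 1 := inv_le_one_of_one_le₀ (one_le_pow₀ hj)
    have hnn := cosRem_nonneg (w + 1) (x := y * (((j + 1 : ℕ) : ℝ) ^ 2)⁻¹) (by positivity)
    have hmu : |((ArithmeticFunction.moebius (j + 1) : ℤ) : ℝ)| ≤ 1 := by
      exact_mod_cast ArithmeticFunction.abs_moebius_le_one
    have hle := cosRem_mul_le w hy.le (by positivity) hi1
    have hrp : ((j + 1 : ℕ) : ℝ) ^ (-(1 / 2) : ℝ) ≤ 1 :=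
      Real.rpow_le_one_of_one_le_of_nonpos hj (by norm_num)
    have hrp0 : 0 ≤ ((j + 1 : ℕ) : ℝ) ^ (-(1 / 2) : ℝ) := by positivity
    simp only [hT]
    rw [abs_mul, abs_mul, abs_of_nonneg hnn, abs_of_nonneg hrp0]
    -- The Möbius value and the weight (j+1)^(-1/2) are bounded by 1; all the decay comes from
    -- `cosRem_mul_le`.
    calc _ ≤ 1 * 1 * ((((j + 1 : ℕ) : ℝ) ^ 2)⁻¹ * R) := by gcongr
      _ = _ := by ring
  have hS : Summable T := Summable.of_norm_bounded (hz.summable.mul_left R) hb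
  have h0 : T 0 = R := by simp [hT, hRdef]
  rw [hS.tsum_eq_zero_add, h0]
  have hz1 := (hasSum_nat_add_iff' 1).2 (hz.mul_left R)
  have hge : -(R * (Real.pi ^ 2 / 6) - ∑ i ∈ Finset.range 1, R * (1 / ((i + 1 : ℕ) : ℝ) ^ 2)) ≤ ∑' j, T (j + 1) := by
    refine hasSum_le (fun j => ?_) (hz1.neg.congr_fun fun j => rfl) ((summable_nat_add_iff 1).2 hS).hasSum
    exact neg_le_of_abs_le (hb (j + 1))
  -- The tail is at least -R(π²/6 - 1), so it cannot cancel the leading term R.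
  have hpi : Real.pi ^ 2 / 6 < 2 := by nlinarith [Real.pi_lt_d2, Real.pi_pos]
  norm_num at hge
  nlinarith

theorem integral_dilWeight_mul_cosRem_pos (w : ℕ) {x : ℝ} (hx : 0 < x) :
    0 < ∫ τ, dilWeight τ * cosRem (w + 1) (x * dilScale τ) ∂dilMeasure := by
  -- At s = 2 the scale enters to the first power, matching the linear bound of `cosRem_mul_le`;
  -- this is the dominating function.
  have h2 := (dilMoment (s := 2) (by norm_num)).1
  have hk : Integrable (fun τ => dilWeight τ * dilScale τ) dilMeasure := by
    simp only [div_self (two_ne_zero' ℂ), Complex.cpow_one] at h2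
    have e2 : ∀ τ, (dilWeight τ : ℂ) * (dilScale τ : ℂ) =
      ((dilWeight τ * dilScale τ : ℝ) : ℂ) := fun τ => by push_cast; rfl
    simp only [e2] at h2
    exact h2.re
  have hi : Integrable (fun τ => dilWeight τ * cosRem (w + 1) (x * dilScale τ)) dilMeasure := by
    refine (hk.norm.mul_const (cosRem (w + 1) x)).mono' ?_ ?_
    · exact (measurable_dilWeight.mul ((continuous_cosRem _).measurable.comp
        (measurable_dilScale.const_mul x))).aestronglyMeasurable
    · filter_upwards [dilScale_pos, dilScale_le_one] with τ h0 h1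
      rw [norm_mul, norm_mul, Real.norm_of_nonneg (cosRem_nonneg _ (mul_pos hx h0).le),
        Real.norm_of_nonneg h0.le, mul_assoc]
      exact mul_le_mul_of_nonneg_left (cosRem_mul_le w hx.le h0.le h1) (norm_nonneg _)
  set μ₂ := (volume.restrict (Ioo (0 : ℝ) 1)).prod (volume.restrict (Ioo (0 : ℝ) 1)) with hμ₂
  have hi' : Integrable (fun τ => dilWeight τ * cosRem (w + 1) (x * dilScale τ))
      (μ₂.prod Measure.count) := hi
  change 0 < ∫ τ, dilWeight τ * cosRem (w + 1) (x * dilScale τ) ∂(μ₂.prod Measure.count)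
  rw [integral_prod _ hi']
  have hpos : ∀ᵐ p ∂μ₂, 0 < ∫ j, dilWeight (p, j) * cosRem (w + 1) (x * dilScale (p, j))
      ∂(Measure.count : Measure ℕ) := by
    have hmem : ∀ᵐ p ∂μ₂, p ∈ Ioo (0 : ℝ) 1 ×ˢ Ioo (0 : ℝ) 1 := by
      rw [hμ₂, Measure.prod_restrict]
      exact ae_restrict_mem (measurableSet_Ioo.prod measurableSet_Ioo)
    filter_upwards [hmem, hi'.prod_right_ae] with p hp hpi
    rw [integral_countable hpi]
    simp only [Measure.real, Measure.count_singleton, ENNReal.toReal_one, one_smul]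
    obtain ⟨⟨hv, hv1⟩, hu, hu1⟩ := hp
    -- Summing over j first isolates the Möbius sum; the remaining weight in (v, u) is positive.
    have hpos := moebius_cosRem_pos w (y := x * (p.1 * p.2)) (by positivity)
    have hc : 0 < p.1 ^ (-(5 / 4) : ℝ) * (1 - p.2) ^ (-(3 / 4) : ℝ) :=
      mul_pos (Real.rpow_pos_of_pos hv _) (Real.rpow_pos_of_pos (sub_pos.2 hu1) _)
    have := mul_pos hc hpos
    rw [← tsum_mul_left] at this
    refine this.trans_eq (tsum_congr fun j => ?_)
    simp only [dilWeight, dilScale]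
    rw [← mul_assoc x (p.1 * p.2)]
    ring
  have hint := hi'.integral_prod_left
  refine lt_of_le_of_ne (integral_nonneg_of_ae (hpos.mono fun p hp => hp.le)) fun h0 => ?_
  have hz := (integral_eq_zero_iff_of_nonneg_ae (hpos.mono fun p hp => hp.le) hint).1 h0.symm
  have hF : ∀ᵐ _p ∂μ₂, False := by
    filter_upwards [hz, hpos] with p h1 h2
    exact h2.ne' h1
  have : μ₂ univ = 0 := by simpa [ae_iff] using hF
  rw [hμ₂, ← univ_prod_univ, Measure.prod_prod] at this
  simp at this

theorem P_pos {w : ℕ} (hw : 1 ≤ w) {x : ℝ} (hx : 0 < x) :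
    (P w (x : ℂ)).im = 0 ∧ 0 < (P w (x : ℂ)).re := by
  obtain ⟨v, rfl⟩ := Nat.exists_eq_add_of_le' hw
  rw [P_ofReal _ hx.le, Complex.ofReal_im, Complex.ofReal_re]
  exact ⟨rfl, mul_pos dilConst_pos (integral_dilWeight_mul_cosRem_pos v hx)⟩

/-! ### The alternating series and the absence of zeros of ζ in (0,1) -/

/-- The grouped alternating series `∑ₙ ((2n+1)^{-s} - (2n+2)^{-s})`. -/
def etaTerm (n : ℕ) (s : ℂ) : ℂ :=
  ((2 * n + 1 : ℕ) : ℂ) ^ (-s) - ((2 * n + 2 : ℕ) : ℂ) ^ (-s)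

/-- The mean value inequality on [2n+1, 2n+2]: pairing gains one power of n, hence absolute
convergence for Re s > 0. -/
theorem norm_etaTerm_le {s : ℂ} {δ : ℝ} (hδ : 0 < δ) (hs : δ ≤ s.re) (n : ℕ) :
    ‖etaTerm n s‖ ≤ ‖s‖ * ((2 * n + 1 : ℕ) : ℝ) ^ (-δ - 1) := by
  have hx : ∀ x ∈ Icc ((2 * n + 1 : ℕ) : ℝ) ((2 * n + 2 : ℕ) : ℝ), 1 ≤ x := fun x hx => by
    refine le_trans ?_ hx.1
    exact_mod_cast (by omega : 1 ≤ 2 * n + 1)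
  have hd : ∀ x ∈ Icc ((2 * n + 1 : ℕ) : ℝ) ((2 * n + 2 : ℕ) : ℝ),
      HasDerivWithinAt (fun x : ℝ => (x : ℂ) ^ (-s)) (-s * (x : ℂ) ^ (-s - 1))
        (Icc ((2 * n + 1 : ℕ) : ℝ) ((2 * n + 2 : ℕ) : ℝ)) x := by
    intro x hx'
    have hs0 : -s ≠ 0 := fun h => by
      have := congrArg Complex.re h
      simp at this
      linarith
    exact (hasDerivAt_ofReal_cpow_const (by linarith [hx x hx']) hs0).hasDerivWithinAt
  have hb : ∀ x ∈ Icc ((2 * n + 1 : ℕ) : ℝ) ((2 * n + 2 : ℕ) : ℝ),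
      ‖-s * (x : ℂ) ^ (-s - 1)‖ ≤ ‖s‖ * ((2 * n + 1 : ℕ) : ℝ) ^ (-δ - 1) := by
    intro x hx'
    have h1 := hx x hx'
    rw [norm_mul, norm_neg, Complex.norm_cpow_eq_rpow_re_of_pos (by linarith)]
    refine mul_le_mul_of_nonneg_left ?_ (norm_nonneg _)
    calc x ^ (-s - 1).re ≤ x ^ (-δ - 1) :=
          Real.rpow_le_rpow_of_exponent_le h1 (by simpa using hs)
      _ ≤ _ := Real.rpow_le_rpow_of_nonpos (by positivity) hx'.1 (by linarith)
  have hle : ((2 * n + 1 : ℕ) : ℝ) ≤ ((2 * n + 2 : ℕ) : ℝ) := by exact_mod_cast Nat.le_succ _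
  have h := (convex_Icc _ _).norm_image_sub_le_of_norm_hasDerivWithin_le hd hb
    (right_mem_Icc.2 hle) (left_mem_Icc.2 hle)
  rw [show ‖((2 * n + 1 : ℕ) : ℝ) - ((2 * n + 2 : ℕ) : ℝ)‖ = 1 by
    push_cast; norm_num, mul_one] at h
  exact h

theorem summable_odd_rpow {δ : ℝ} (hδ : 0 < δ) :
    Summable fun n : ℕ => ((2 * n + 1 : ℕ) : ℝ) ^ (-δ - 1) :=
  (Real.summable_nat_rpow.2 (by linarith : -δ - 1 < -1)).comp_injective
    (i := fun n : ℕ => 2 * n + 1) fun a b h => by simpa using h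

theorem analyticOnNhd_eta : AnalyticOnNhd ℂ (fun s => ∑' n, etaTerm n s) {s | 0 < s.re} := by
  refine DifferentiableOn.analyticOnNhd (fun s hs => ?_) (isOpen_lt continuous_const continuous_re)
  have hs : 0 < s.re := hs
  set U : Set ℂ := {z | s.re / 2 < z.re} ∩ Metric.ball 0 (‖s‖ + 1)
  have hU : IsOpen U := (isOpen_lt continuous_const continuous_re).inter Metric.isOpen_ball
  have hsU : s ∈ U := ⟨half_lt_self hs, by simp⟩
  have h : DifferentiableOn ℂ (fun s => ∑' n, etaTerm n s) U := by
    refine differentiableOn_tsum_of_summable_norm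
      ((summable_odd_rpow (half_pos hs)).mul_left (‖s‖ + 1)) (fun n => ?_) hU fun n z hz => ?_
    · intro z _
      refine DifferentiableAt.differentiableWithinAt ?_
      unfold etaTerm
      have h1 : ((2 * n + 1 : ℕ) : ℂ) ≠ 0 := Nat.cast_ne_zero.2 (by omega)
      have h2 : ((2 * n + 2 : ℕ) : ℂ) ≠ 0 := Nat.cast_ne_zero.2 (by omega)
      exact ((differentiableAt_id.neg).const_cpow (Or.inl h1)).sub
        ((differentiableAt_id.neg).const_cpow (Or.inl h2))
    · refine (norm_etaTerm_le (half_pos hs) hz.1.le n).trans ?_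
      gcongr
      exact (mem_ball_zero_iff.1 hz.2).le
  exact (h.differentiableAt (hU.mem_nhds hsU)).differentiableWithinAt

theorem eta_eq_of_one_lt_re {s : ℂ} (hs : 1 < s.re) :
    ∑' n, etaTerm n s = (1 - 2 * 2 ^ (-s)) * riemannZeta s := by
  have hz := zeta_eq_tsum_one_div_nat_add_one_cpow hs
  set g : ℕ → ℂ := fun n => ((n + 1 : ℕ) : ℂ) ^ (-s) with hg
  have hgS : Summable g := by
    have h := (summable_nat_add_iff 1).2 (Complex.summable_one_div_nat_cpow.2 hs)
    refine h.congr fun n => ?_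
    simp only [hg]
    rw [Complex.cpow_neg, one_div]
  have hz' : riemannZeta s = ∑' n, g n := by
    rw [hz]
    refine tsum_congr fun n => ?_
    simp only [hg]
    rw [Complex.cpow_neg, one_div]
    push_cast; rfl
  have he : Summable fun n => g (2 * n) := hgS.comp_injective fun a b h => by simpa using h
  have ho : Summable fun n => g (2 * n + 1) := hgS.comp_injective fun a b h => by simpa using h
  have hsplit := tsum_even_add_odd he ho
  have hodd : ∑' n, g (2 * n + 1) = 2 ^ (-s) * riemannZeta s := by
    rw [hz', ← tsum_mul_left]
    refine tsum_congr fun n => ?_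
    simp only [hg]
    rw [show 2 * n + 1 + 1 = 2 * (n + 1) by ring, Nat.cast_mul, Complex.natCast_mul_natCast_cpow]
    rfl
  have : ∑' n, etaTerm n s = ∑' n, g (2 * n) - ∑' n, g (2 * n + 1) := by
    rw [← he.tsum_sub ho]
    rfl
  rw [this, hodd]
  rw [hodd, ← hz'] at hsplit
  linear_combination hsplit

/-- Analytic continuation of `eta_eq_of_one_lt_re` from Re s > 1. Multiplying by s - 1 and using the
entire `riemannZeta₁` removes the pole, so the domain is the full half-plane. -/
theorem eta_eq {s : ℂ} (hs : 0 < s.re) :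
    (s - 1) * ∑' n, etaTerm n s = (1 - 2 * 2 ^ (-s)) * riemannZeta₁ s := by
  have hL : AnalyticOnNhd ℂ (fun s : ℂ => (s - 1) * ∑' n, etaTerm n s) {s | 0 < s.re} :=
    (analyticOnNhd_id.sub analyticOnNhd_const).mul analyticOnNhd_eta
  have hR : AnalyticOnNhd ℂ (fun s : ℂ => (1 - 2 * 2 ^ (-s)) * riemannZeta₁ s) {s | 0 < s.re} := by
    intro z _
    refine Differentiable.analyticAt ?_ z
    refine Differentiable.mul (fun z => ?_) differentiable_riemannZeta₁
    exact (differentiableAt_const _).sub ((differentiableAt_const _).mul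
      (differentiableAt_id.neg.const_cpow (Or.inl two_ne_zero)))
  have hconn : IsPreconnected {s : ℂ | 0 < s.re} := (convex_halfSpace_re_gt 0).isPreconnected
  refine hL.eqOn_of_preconnected_of_eventuallyEq hR hconn (z₀ := 2) (by simp) ?_ hs
  have hopen : IsOpen {s : ℂ | 1 < s.re} := isOpen_lt continuous_const continuous_re
  filter_upwards [hopen.mem_nhds (show (2 : ℂ) ∈ {s : ℂ | 1 < s.re} by simp)] with z hz
  have hz1 : z ≠ 1 := fun h => by simp [h] at hz
  rw [eta_eq_of_one_lt_re hz, riemannZeta_eq_inv_sub_mul hz1]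
  have := sub_ne_zero.2 hz1
  field_simp

/-- For real x every grouped term is positive, so the sum is nonzero, whereas a zero of ζ would
force it to vanish by `eta_eq`. -/
theorem riemannZeta_ne_zero_of_mem_Ioo {x : ℝ} (h0 : 0 < x) (h1 : x < 1) :
    riemannZeta (x : ℂ) ≠ 0 := by
  intro hz
  have hx1 : (x : ℂ) ≠ 1 := by exact_mod_cast h1.ne
  have hx1' := sub_ne_zero.2 hx1
  have h := eta_eq (s := x) (by simpa using h0)
  rw [riemannZeta_eq_inv_sub_mul hx1] at hz
  have hz1 : riemannZeta₁ (x : ℂ) = 0 := by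
    rcases mul_eq_zero.1 hz with h | h
    · exact absurd h (inv_ne_zero hx1')
    · exact h
  rw [hz1, mul_zero] at h
  have hE := (mul_eq_zero.1 h).resolve_left hx1'
  have e : ∀ n : ℕ, etaTerm n x =
      ((((2 * n + 1 : ℕ) : ℝ) ^ (-x) - ((2 * n + 2 : ℕ) : ℝ) ^ (-x) : ℝ) : ℂ) := by
    intro n
    rw [etaTerm, Complex.ofReal_sub, Complex.ofReal_cpow (by positivity),
      Complex.ofReal_cpow (by positivity)]
    push_cast
    rfl
  have hpos : ∀ n : ℕ, 0 < ((2 * n + 1 : ℕ) : ℝ) ^ (-x) - ((2 * n + 2 : ℕ) : ℝ) ^ (-x) := by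
    intro n
    refine sub_pos.2 (Real.rpow_lt_rpow_of_neg (by positivity) ?_ (by linarith))
    exact_mod_cast Nat.lt_succ_self _
  have hS : Summable fun n : ℕ => ((2 * n + 1 : ℕ) : ℝ) ^ (-x) - ((2 * n + 2 : ℕ) : ℝ) ^ (-x) := by
    refine Summable.of_norm_bounded ((summable_odd_rpow h0).mul_left ‖(x : ℂ)‖) fun n => ?_
    have := norm_etaTerm_le h0 (s := x) (by simp) n
    rwa [e, Complex.norm_real] at this
  simp only [e] at hE
  rw [← Complex.ofReal_tsum, Complex.ofReal_eq_zero] at hE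
  exact (hS.tsum_pos (fun n => (hpos n).le) 0 (hpos 0)).ne' hE

/-! ### Zeros of `xi` and of `n` -/

theorem xi_one_sub (s : ℂ) : xi (1 - s) = xi s := by
  rw [xi, xi, completedRiemannZeta₀_one_sub]; ring

theorem xi_eq_zero_iff {s : ℂ} (hs : 0 < s.re) (h1 : s ≠ 1) : xi s = 0 ↔ riemannZeta s = 0 := by
  rw [xi_eq h1, a, l]
  · have h2 : (Real.pi : ℂ) ^ (-s / 2) ≠ 0 := by
      rw [ofReal_cpow_eq_exp Real.pi_pos]; exact Complex.exp_ne_zero _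
    have h3 : Gamma (1 + s / 2) ≠ 0 := Gamma_ne_zero_of_re_pos (by
      rw [add_re, one_re, show (s / 2).re = s.re / 2 by simp]; linarith)
    simp [h2, h3, sub_ne_zero.2 h1]
  · intro m h
    have := congrArg Complex.re h
    simp at this
    have h2 : (0 : ℝ) ≤ m := m.cast_nonneg
    linarith

theorem xi_ne_zero_of_one_le_re {s : ℂ} (hs : 1 ≤ s.re) : xi s ≠ 0 := by
  rcases eq_or_ne s 1 with rfl | h1
  · norm_num [xi]
  · rw [Ne, xi_eq_zero_iff (by linarith) h1]
    exact riemannZeta_ne_zero_of_one_le_re hs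

/-- Nonvanishing on Re ≥ 1 and its reflection confine the zeros of ξ to the open critical strip,
where they are zeros of ζ, and none of these is real. -/
theorem xi_half_add_eq_zero_iff (s : ℂ) : xi (1 / 2 + s) = 0 ↔ s ∈ Zi := by
  have hre : (1 / 2 + s).re = 1 / 2 + s.re := by
    rw [add_re]; congr 1; norm_num
  have him : (1 / 2 + s).im = s.im := by
    rw [add_im, add_eq_right]; norm_num
  constructor
  · intro h
    have hlt : (1 / 2 + s).re < 1 := by
      by_contra hc
      exact xi_ne_zero_of_one_le_re (not_lt.1 hc) h
    have hgt : 0 < (1 / 2 + s).re := by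
      by_contra hc
      rw [← xi_one_sub] at h
      exact xi_ne_zero_of_one_le_re (by rw [sub_re, one_re]; linarith) h
    have hne : 1 / 2 + s ≠ 1 := fun hc => by rw [hc] at hlt; simp at hlt
    have hz := (xi_eq_zero_iff hgt hne).1 h
    refine ⟨hz, fun hs => ?_⟩
    have hreal : 1 / 2 + s = (((1 / 2 + s).re : ℝ) : ℂ) :=
      Complex.ext (by simp) (by rw [him, hs, Complex.ofReal_im])
    rw [hreal] at hz
    exact riemannZeta_ne_zero_of_mem_Ioo hgt hlt hz
  · rintro ⟨hz, hs⟩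
    have h1 : 1 / 2 + s ≠ 1 := fun hc => hs (by rw [← him, hc, one_im])
    have h2 : ∀ m : ℕ, 1 / 2 + s ≠ -2 * (m + 1) := fun m hc => hs (by rw [← him, hc]; simp)
    rw [xi_eq h1 h2, hz, mul_zero]

theorem isOpen_compl_Zi : IsOpen Ziᶜ := by
  have : Ziᶜ = (fun s => xi (1 / 2 + s)) ⁻¹' {0}ᶜ := by
    ext s
    simp [← xi_half_add_eq_zero_iff]
  rw [this]
  exact isOpen_compl_singleton.preimage
    (differentiable_xi.continuous.comp (continuous_const.add continuous_id))

theorem xi_half_add_neg (s : ℂ) : xi (1 / 2 + -s) = xi (1 / 2 + s) := by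
  rw [← xi_one_sub]; congr 1; ring

theorem half_le_abs_re_subset_compl_Zi : {s : ℂ | 1 / 2 ≤ |s.re|} ⊆ Ziᶜ := by
  intro s hs hc
  have hre : ∀ s : ℂ, (1 / 2 + s).re = 1 / 2 + s.re := fun s => by
    rw [add_re]; congr 1; norm_num
  rw [← xi_half_add_eq_zero_iff] at hc
  rcases le_abs.1 (show 1 / 2 ≤ |s.re| from hs) with h | h
  · exact xi_ne_zero_of_one_le_re (by rw [hre]; linarith) hc
  · rw [← xi_half_add_neg] at hc
    exact xi_ne_zero_of_one_le_re (by rw [hre, neg_re]; linarith) hc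

theorem differentiable_n : Differentiable ℂ n := by
  have := differentiable_xi
  unfold n
  fun_prop

theorem n_neg (s : ℂ) : n (-s) = -n s := by
  rw [n, n, xi_half_add_neg, mul_neg, neg_div, Complex.sin_neg, neg_mul]

theorem sin_pi_mul_div_four_eq_zero_iff (s : ℂ) : sin (Real.pi * s / 4) = 0 ↔ s ∈ fourZ := by
  rw [Complex.sin_eq_zero_iff]
  have hpi : (Real.pi : ℂ) ≠ 0 := by exact_mod_cast Real.pi_ne_zero
  refine exists_congr fun k => ?_
  constructor
  · intro h
    refine mul_left_cancel₀ hpi ?_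
    linear_combination 4 * h
  · rintro rfl
    ring

theorem n_ne_zero {s : ℂ} (h1 : s ∉ fourZ) (h2 : s ∉ Zi) : n s ≠ 0 := by
  rw [← sin_pi_mul_div_four_eq_zero_iff] at h1
  rw [← xi_half_add_eq_zero_iff] at h2
  exact mul_ne_zero h1 (mul_ne_zero two_ne_zero h2)

theorem analyticAt_f {s : ℂ} (h1 : s ∉ fourZ) (h2 : s ∉ Zi) : AnalyticAt ℂ f s :=
  analyticAt_const.div (differentiable_n.analyticAt s) (n_ne_zero h1 h2)

theorem notMem_Zi_of_half_le_re {s : ℂ} (h : 1 / 2 ≤ s.re) : s ∉ Zi :=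
  half_le_abs_re_subset_compl_Zi (show 1 / 2 ≤ |s.re| from h.trans (le_abs_self _))

theorem analyticOnNhd_f_strip {x₀ x₁ : ℝ} (w : ℕ) (h : 1 / 2 ≤ x₀) (h0 : 4 * w ≤ x₀)
    (h1 : x₁ ≤ 4 * w + 4) : AnalyticOnNhd ℂ f (strip x₀ x₁) := by
  rintro s ⟨hs0, hs1⟩
  refine analyticAt_f ?_ (notMem_Zi_of_half_le_re (by linarith))
  rintro ⟨k, rfl⟩
  have e : ((4 * k : ℂ)).re = 4 * k := by simp
  rw [e] at hs0 hs1
  have h2 : (w : ℝ) < k := by linarith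
  have h3 : (k : ℝ) < w + 1 := by linarith
  have h2' : (w : ℤ) < k := by exact_mod_cast h2
  have h3' : k < (w : ℤ) + 1 := by exact_mod_cast h3
  omega

/-! ### The residues c(4k) -/

theorem deriv_n_four_mul (k : ℤ) :
    deriv n (4 * k) = Real.pi / 4 * (cos (k * Real.pi) * (2 * xi (1 / 2 + 4 * k))) := by
  have h1 : HasDerivAt (fun s : ℂ => sin (Real.pi * s / 4))
      (cos (Real.pi * (4 * k) / 4) * (Real.pi * 1 / 4)) (4 * (k : ℂ)) :=
    (((hasDerivAt_id (4 * (k : ℂ))).const_mul (Real.pi : ℂ)).div_const 4).csin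
  have h2 : DifferentiableAt ℂ (fun s : ℂ => 2 * xi (1 / 2 + s)) (4 * (k : ℂ)) := by
    have := differentiable_xi
    fun_prop
  have h3 := (h1.mul h2.hasDerivAt).deriv
  have hs : sin (Real.pi * (4 * k) / 4) = 0 :=
    (sin_pi_mul_div_four_eq_zero_iff _).2 ⟨k, rfl⟩
  rw [show n = (fun s : ℂ => sin (Real.pi * s / 4)) * fun s : ℂ => 2 * xi (1 / 2 + s) from rfl, h3,
    hs, show (Real.pi * (4 * k) / 4 : ℂ) = k * Real.pi by ring]
  ring

theorem four_mul_intCast_notMem_Zi (k : ℤ) : (4 * k : ℂ) ∉ Zi := fun h => h.2 (by simp)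

theorem deriv_n_four_mul_ne_zero (k : ℤ) : deriv n (4 * k) ≠ 0 := by
  have hpi : (Real.pi : ℂ) ≠ 0 := by exact_mod_cast Real.pi_ne_zero
  rw [deriv_n_four_mul]
  refine mul_ne_zero (div_ne_zero hpi (by norm_num)) (mul_ne_zero ?_ (mul_ne_zero two_ne_zero ?_))
  · intro h
    have h2 := Complex.sin_sq_add_cos_sq (k * Real.pi)
    rw [h, Complex.sin_int_mul_pi] at h2
    norm_num at h2
  · rw [Ne, xi_half_add_eq_zero_iff]
    exact four_mul_intCast_notMem_Zi k

theorem c_neg (s : ℂ) : c (-s) = c s := by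
  have h : deriv n (-s) = deriv n s := by
    have h1 := deriv_comp_neg (f := n) (x := s)
    have h2 : (fun x => n (-x)) = fun x => -n x := funext n_neg
    rw [h2, deriv.fun_neg] at h1
    exact (neg_injective h1).symm
  rw [c, c, h]

/-- The link between the residues and the power series: c(4k) is the k-th coefficient term evaluated
at z = π. -/
theorem c_four_mul {k : ℕ} (hk : 1 ≤ k) : c (4 * k) = (-(Real.pi : ℂ) ^ 2) ^ k * ctilde k := by
  have hk' : (1 : ℝ) ≤ k := by exact_mod_cast hk
  have h := deriv_n_four_mul k
  push_cast at h
  have hcos : cos (k * Real.pi) = (-1) ^ k := by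
    exact_mod_cast congrArg Complex.ofReal (Real.cos_nat_mul_pi k)
  rw [c, h, two_mul_xi_half_add (by simp; linarith), hcos, ctilde,
    show (4 * k / 2 : ℂ) = 2 * k by ring, show (4 * k - 1 / 2 : ℂ) = 2 * (2 * k - 1 / 4) by ring]
  have hL : (Real.pi : ℂ) = exp (Real.log Real.pi : ℝ) := by
    rw [← Complex.ofReal_exp, Real.exp_log Real.pi_pos]
  rw [Complex.ofReal_cpow Real.pi_pos.le, ofReal_cpow_eq_exp Real.pi_pos,
    ofReal_cpow_eq_exp Real.pi_pos, neg_pow ((Real.pi : ℂ) ^ 2), ← pow_mul]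
  generalize (Real.log Real.pi : ℝ) = L at hL
  have hexp : exp (L * ((3 / 4 : ℝ) : ℂ)) =
      (Real.pi : ℂ) * (Real.pi : ℂ) ^ (2 * k) * exp (L * (-(1 / 2 + 4 * k) / 2)) := by
    rw [hL, ← Complex.exp_nat_mul, ← Complex.exp_add, ← Complex.exp_add]
    congr 1
    push_cast
    ring
  have hpi : (Real.pi : ℂ) ≠ 0 := by exact_mod_cast Real.pi_ne_zero
  have hm : ((-1 : ℂ) ^ k)⁻¹ = (-1) ^ k := by
    rw [← inv_pow]; norm_num
  rw [hexp]
  generalize 2 * (k : ℂ) - 1 / 4 = D, Gamma (5 / 4 + 2 * k) = G, riemannZeta (1 / 2 + 4 * k) = Z,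
    exp (L * (-(1 / 2 + 4 * k) / 2)) = E
  simp only [div_eq_mul_inv, mul_inv, one_mul, inv_inv, hm]
  field_simp
  ring

theorem summable_norm_c : Summable fun k : ℕ => ‖c (4 * ((k + 1 : ℕ) : ℂ))‖ := by
  refine (summable_ctilde_mul_pow Real.pi).congr fun k => ?_
  rw [c_four_mul (by omega), norm_mul, norm_pow, norm_neg, norm_pow, Complex.norm_real,
    Real.norm_of_nonneg Real.pi_pos.le, mul_comm]

theorem summable_norm_c_int : Summable fun j : ℤ => ‖c (4 * j)‖ := by
  refine Summable.of_add_one_of_neg_add_one ?_ ?_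
  · refine summable_norm_c.congr fun k => ?_
    push_cast; rfl
  · refine summable_norm_c.congr fun k => ?_
    rw [← c_neg]
    push_cast
    congr 2
    ring

/-! ### Partial fractions and removal of the real poles -/

theorem exists_two_le_norm_sub (s : ℂ) : ∃ k : ℤ, ∀ j : ℤ, j ≠ k → 2 ≤ ‖s - 4 * j‖ := by
  refine ⟨round (s.re / 4), fun j hj => ?_⟩
  have h1 := abs_sub_round (s.re / 4)
  have h2 : (1 : ℝ) ≤ |(round (s.re / 4) : ℝ) - j| := by
    exact_mod_cast Int.one_le_abs (sub_ne_zero.2 hj.symm)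
  have h3 := abs_re_le_norm (s - 4 * j)
  have h4 : (s - 4 * j).re = s.re - 4 * j := by simp
  rw [h4] at h3
  refine le_trans ?_ h3
  have h5 : |(round (s.re / 4) : ℝ) - j| ≤ |(round (s.re / 4) : ℝ) - s.re / 4| + |s.re / 4 - j| :=
    abs_sub_le _ _ _
  rw [abs_sub_comm _ (s.re / 4)] at h5
  have h6 : |s.re - 4 * j| = 4 * |s.re / 4 - j| := by
    rw [show s.re - 4 * j = 4 * (s.re / 4 - j) by ring, abs_mul, abs_of_pos four_pos]
  rw [h6]
  linarith

theorem summable_norm_partialFraction {b : ℤ → ℂ} (hb : Summable fun j => ‖b j‖) (s : ℂ) :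
    Summable fun j : ℤ => ‖b j / (s - 4 * j)‖ := by
  obtain ⟨k, hk⟩ := exists_two_le_norm_sub s
  -- The nearest index is dominated by its own norm. At a pole that term is 0, as division by zero
  -- gives 0, so no point needs to be excluded.
  refine Summable.of_nonneg_of_le (fun _ => norm_nonneg _) (fun j => ?_)
    (hb.add (hasSum_ite_eq k ‖b k / (s - 4 * k)‖).summable)
  by_cases hj : j = k
  · subst hj
    simp
  · rw [if_neg hj, add_zero, norm_div]
    exact div_le_self (norm_nonneg _) (by linarith [hk j hj])

/-- Near a point, a partial fraction series is its nearest pole plus an analytic function. -/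
theorem exists_partialFraction_eq {b : ℤ → ℂ} (hb : Summable fun j => ‖b j‖) {s₀ : ℂ} {k : ℤ}
    (hk : ∀ j : ℤ, j ≠ k → 2 ≤ ‖s₀ - 4 * j‖) :
    ∃ T : ℂ → ℂ, AnalyticAt ℂ T s₀ ∧
      ∀ s, ∑' j : ℤ, b j / (s - 4 * j) = b k / (s - 4 * k) + T s := by
  refine ⟨fun s => ∑' j : ℤ, if j = k then 0 else b j / (s - 4 * j), ?_, fun s => ?_⟩
  · refine DifferentiableOn.analyticAt (s := Metric.ball s₀ 1) ?_ (Metric.ball_mem_nhds _ one_pos)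
    have hfar : ∀ j : ℤ, j ≠ k → ∀ s ∈ Metric.ball s₀ 1, 1 ≤ ‖s - 4 * j‖ := by
      intro j hj s hs
      have h1 := hk j hj
      have h2 := mem_ball_iff_norm'.1 hs
      have h3 := norm_add_le (s₀ - s) (s - 4 * j)
      rw [sub_add_sub_cancel] at h3
      linarith
    refine differentiableOn_tsum_of_summable_norm hb (fun j => ?_) Metric.isOpen_ball
      fun j s hs => ?_
    · by_cases hj : j = k
      · simp only [if_pos hj]; fun_prop
      · simp only [if_neg hj]
        refine DifferentiableOn.div (by fun_prop) (by fun_prop) fun s hs h0 => ?_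
        have := hfar j hj s hs
        rw [h0, norm_zero] at this
        linarith
    · by_cases hj : j = k
      · simp [hj]
      · rw [if_neg hj, norm_div]
        exact div_le_self (norm_nonneg _) (hfar j hj s hs)
  · exact (summable_norm_partialFraction hb s).of_norm.tsum_eq_add_tsum_ite k

theorem summable_norm_FTerm (s : ℂ) : Summable fun w : ℕ => ‖FTerm s (w + 1)‖ := by
  have h := (summable_norm_partialFraction summable_norm_c_int s).comp_injective
    (i := fun w : ℕ => ((w + 1 : ℕ) : ℤ)) fun a b hab => by simpa using hab
  refine h.congr fun w => ?_
  simp [FTerm]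

/-- Since `c` is even, -F(-s) collects exactly the terms with negative index. -/
theorem pr_eq_tsum (s : ℂ) : pr s = ∑' j : ℤ, c (4 * j) / (s - 4 * j) := by
  have h1 := (summable_norm_FTerm s).of_norm.hasSum
  have h2 := (summable_norm_FTerm (-s)).of_norm.hasSum.neg
  have h := HasSum.of_add_one_of_neg_add_one (f := fun j : ℤ => c (4 * j) / (s - 4 * j))
    (h1.congr_fun fun w => ?_) (h2.congr_fun fun w => ?_)
  · rw [h.tsum_eq, pr, F, F]
    simp only [Int.cast_zero, mul_zero, sub_zero]
    ring
  · simp only [FTerm]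
    push_cast; rfl
  · simp only [FTerm]
    rw [← c_neg, ← neg_div_neg_eq, neg_div]
    push_cast
    ring_nf

/-- Local extensions glue because each value is forced to be the limit over the punctured
neighbourhood; that limit serves as the global definition. -/
theorem exists_analyticOnNhd_extension {g : ℂ → ℂ} {U : Set ℂ}
    (h : ∀ s ∈ U, ∃ φ : ℂ → ℂ, AnalyticAt ℂ φ s ∧ ∀ᶠ z in nhdsWithin s {s}ᶜ, g z = φ z) :
    ∃ H : ℂ → ℂ, AnalyticOnNhd ℂ H U ∧ ∀ s, AnalyticAt ℂ g s → H s = g s := by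
  have key : ∀ (φ : ℂ → ℂ) (s : ℂ), ContinuousAt φ s →
      (∀ᶠ z in nhdsWithin s {s}ᶜ, g z = φ z) → Filter.limUnder (nhdsWithin s {s}ᶜ) g = φ s := by
    intro φ s hφ hg
    refine Filter.Tendsto.limUnder_eq ?_
    exact (hφ.tendsto.mono_left nhdsWithin_le_nhds).congr' (hg.mono fun z hz => hz.symm)
  refine ⟨fun s => Filter.limUnder (nhdsWithin s {s}ᶜ) g, fun s hs => ?_, fun s hs =>
    key g s hs.continuousAt (Filter.Eventually.of_forall fun _ => rfl)⟩
  obtain ⟨φ, hφ, hg⟩ := h s hs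
  refine hφ.congr ?_
  have h1 := hφ.eventually_analyticAt
  have h2 := eventually_eventually_nhdsWithin.2 hg
  rw [eventually_nhdsWithin_iff] at h2
  filter_upwards [h1, h2] with y hy1 hy2
  refine (key φ y hy1.continuousAt ?_).symm
  by_cases hys : y = s
  · subst hys; exact hg
  · refine Filter.Eventually.filter_mono ?_ (hy2 hys)
    rw [isOpen_compl_singleton.nhdsWithin_eq hys]
    exact nhdsWithin_le_nhds

theorem analyticAt_pr {s : ℂ} (hs : s ∉ fourZ) : AnalyticAt ℂ pr s := by
  obtain ⟨k, hk⟩ := exists_two_le_norm_sub s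
  obtain ⟨T, hT, he⟩ := exists_partialFraction_eq summable_norm_c_int hk
  have : pr = fun s => c (4 * k) / (s - 4 * k) + T s := by
    ext z; rw [pr_eq_tsum, he]
  rw [this]
  refine AnalyticAt.add ?_ hT
  exact analyticAt_const.div (analyticAt_id.sub analyticAt_const) (sub_ne_zero.2 fun h => hs ⟨k, h⟩)

theorem exists_analytic_extension_f_sub_pr :
    ∃ h : ℂ → ℂ, AnalyticOnNhd ℂ h Ziᶜ ∧ ∀ s ∉ fourZ ∪ Zi, h s = f s - pr s := by
  suffices hloc : ∀ s ∈ Ziᶜ, ∃ φ : ℂ → ℂ, AnalyticAt ℂ φ s ∧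
      ∀ᶠ z in nhdsWithin s {s}ᶜ, f z - pr z = φ z by
    obtain ⟨H, h1, h2⟩ := exists_analyticOnNhd_extension hloc
    refine ⟨H, h1, fun s hs => h2 s ?_⟩
    rw [mem_union, not_or] at hs
    exact (analyticAt_f hs.1 hs.2).sub (analyticAt_pr hs.1)
  intro s hs
  by_cases h4 : s ∈ fourZ
  swap
  · exact ⟨_, (analyticAt_f h4 hs).sub (analyticAt_pr h4), Filter.Eventually.of_forall fun _ => rfl⟩
  obtain ⟨k, rfl⟩ := h4
  have hk : ∀ j : ℤ, j ≠ k → 2 ≤ ‖(4 * k : ℂ) - 4 * j‖ := by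
    intro j hj
    have h : (1 : ℝ) ≤ ‖((k - j : ℤ) : ℂ)‖ := by
      rw [Complex.norm_intCast]
      exact_mod_cast Int.one_le_abs (sub_ne_zero.2 hj.symm)
    rw [← mul_sub, norm_mul, ← Int.cast_sub, Complex.norm_ofNat]
    linarith
  obtain ⟨T, hT, he⟩ := exists_partialFraction_eq summable_norm_c_int hk
  have hn0 : n (4 * k) = 0 := by
    rw [n, (sin_pi_mul_div_four_eq_zero_iff _).2 ⟨k, rfl⟩, zero_mul]
  -- Factor n(s) = (s - 4k) m(s) with m(4k) = n'(4k) ≠ 0. Then 1/n minus its principal part is the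
  -- difference quotient of 1/m at 4k, which is analytic there.
  set m : ℂ → ℂ := dslope n (4 * k) with hm
  have hmd : Differentiable ℂ m := by
    rw [← differentiableOn_univ, hm, Complex.differentiableOn_dslope Filter.univ_mem]
    exact differentiable_n.differentiableOn
  have hm0 : m (4 * k) = deriv n (4 * k) := dslope_same _ _
  have hmne : m (4 * k) ≠ 0 := hm0 ▸ deriv_n_four_mul_ne_zero k
  have hma : AnalyticAt ℂ (fun s => 1 / m s) (4 * k) :=
    analyticAt_const.div (hmd.analyticAt _) hmne
  obtain ⟨V, hV, hVd⟩ := hma.exists_mem_nhds_analyticOnNhd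
  have hds : AnalyticAt ℂ (dslope (fun s => 1 / m s) (4 * k)) (4 * k) := by
    refine DifferentiableOn.analyticAt (s := V) ?_ hV
    rw [Complex.differentiableOn_dslope hV]
    exact hVd.differentiableOn
  refine ⟨fun s => dslope (fun s => 1 / m s) (4 * k) s - T s, hds.sub hT, ?_⟩
  have hmne' : ∀ᶠ z in nhdsWithin (4 * k : ℂ) {(4 * k : ℂ)}ᶜ, m z ≠ 0 :=
    (hmd.continuous.continuousAt.eventually_ne hmne).filter_mono nhdsWithin_le_nhds
  filter_upwards [hmne', self_mem_nhdsWithin] with z hz hzk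
  have hzk : z - 4 * k ≠ 0 := sub_ne_zero.2 hzk
  have hnz : n z = (z - 4 * k) * m z := by
    have := sub_smul_dslope n (4 * k) z
    rw [hn0, sub_zero] at this
    exact this.symm
  have hdz := sub_smul_dslope (fun s => 1 / m s) (4 * k) z
  rw [smul_eq_mul] at hdz
  rw [pr_eq_tsum, he, f, hnz, c, ← hm0, ← sub_sub]
  congr 1
  refine mul_left_cancel₀ hzk ?_
  rw [hdz]
  field_simp

/-! ### The half-line Laplace integral for `F` -/

theorem laplaceIntegrand_P0_eq (s : ℂ) (y : ℝ) :
    HasSum (fun k : ℕ => -c (4 * ((k + 1 : ℕ) : ℂ)) * exp ((s - 4 * ((k + 1 : ℕ) : ℂ)) * y))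
      (laplaceIntegrand P0 s y) := by
  have h := (summable_P0Term ((Real.pi * Real.exp (-2 * y) : ℝ) : ℂ)).hasSum.mul_left (exp (s * y))
  refine h.congr_fun fun k => ?_
  rw [P0Term_eq, c_four_mul (by omega), sub_mul, sub_eq_add_neg, Complex.exp_add]
  have e : (-((Real.pi * Real.exp (-2 * y) : ℝ) : ℂ) ^ 2) ^ (k + 1) =
      (-(Real.pi : ℂ) ^ 2) ^ (k + 1) * exp (-(4 * ((k + 1 : ℕ) : ℂ) * y)) := by
    have h2 : exp (-(4 * ((k + 1 : ℕ) : ℂ) * y)) = (exp (-2 * y) ^ 2) ^ (k + 1) := by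
      rw [← Complex.exp_nat_mul, ← Complex.exp_nat_mul]
      congr 1
      push_cast
      ring
    rw [h2, ← mul_pow]
    push_cast
    congr 1
    ring
  rw [e]
  ring

/-- For y > 0 each exponential is at most e^{(Re s - 4)y} in norm, and the c(4k) are absolutely
summable. This dominates the series, and termwise integration gives c(4k)/(s - 4k). -/
theorem laplace_half_line {s : ℂ} (hs : s.re < 4) :
    IntegrableOn (laplaceIntegrand P0 s) (Ioi 0) ∧
      F s = ∫ y in Ioi (0 : ℝ), laplaceIntegrand P0 s y := by
  have hre : ∀ k : ℕ, (s - 4 * ((k + 1 : ℕ) : ℂ)).re = s.re - 4 * (k + 1) := fun k => by simp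
  have hre_neg : ∀ k : ℕ, (s - 4 * ((k + 1 : ℕ) : ℂ)).re < 0 := fun k => by
    rw [hre]
    have : (0 : ℝ) ≤ k := k.cast_nonneg
    linarith
  have hbound : ∀ (k : ℕ) (y : ℝ), 0 < y →
      ‖-c (4 * ((k + 1 : ℕ) : ℂ)) * exp ((s - 4 * ((k + 1 : ℕ) : ℂ)) * y)‖ ≤
        ‖c (4 * ((k + 1 : ℕ) : ℂ))‖ * Real.exp ((s.re - 4) * y) := by
    intro k y hy
    rw [norm_mul, norm_neg, Complex.norm_exp, Complex.re_mul_ofReal, hre]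
    gcongr
    have : (0 : ℝ) ≤ k := k.cast_nonneg
    linarith
  have hexp := integrableOn_exp_mul_Ioi (a := s.re - 4) (by linarith) 0
  constructor
  · refine (hexp.const_mul (∑' k : ℕ, ‖c (4 * ((k + 1 : ℕ) : ℂ))‖)).mono' ?_ ?_
    · have := differentiable_P0.continuous
      unfold laplaceIntegrand
      exact Continuous.aestronglyMeasurable (by fun_prop)
    · filter_upwards [ae_restrict_mem measurableSet_Ioi] with y hy
      rw [← (laplaceIntegrand_P0_eq s y).tsum_eq]
      exact tsum_of_norm_bounded (summable_norm_c.hasSum.mul_right _) fun k => hbound k y hy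
  · have hi : ∀ k : ℕ, IntegrableOn (fun y : ℝ => -c (4 * ((k + 1 : ℕ) : ℂ)) *
        exp ((s - 4 * ((k + 1 : ℕ) : ℂ)) * y)) (Ioi 0) := fun k =>
      (integrableOn_exp_mul_complex_Ioi (hre_neg k) 0).const_mul _
    have h := hasSum_integral_of_summable_integral_norm hi ?_
    · simp only [(laplaceIntegrand_P0_eq s _).tsum_eq] at h
      rw [← h.tsum_eq, F]
      refine tsum_congr fun k => ?_
      rw [integral_const_mul, integral_exp_mul_complex_Ioi (hre_neg k) 0, FTerm]
      simp only [Complex.ofReal_zero, mul_zero, Complex.exp_zero]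
      ring
    · refine Summable.of_nonneg_of_le (fun k => integral_nonneg fun _ => norm_nonneg _) (fun k => ?_)
        (summable_norm_c.mul_right (∫ y in Ioi (0 : ℝ), Real.exp ((s.re - 4) * y)))
      rw [← integral_const_mul]
      exact setIntegral_mono_on (hi k).norm (hexp.const_mul _) measurableSet_Ioi
        fun y hy => hbound k y hy

end ZetaLaplace

end

theorem mainTheorem1 :
    -- (1)
    ((∀ z, Summable fun k : ℕ => ZetaLaplace.P0Term z (k + 1)) ∧
      Differentiable ℂ ZetaLaplace.P0 ∧
      (∀ z, ZetaLaplace.P0 (-z) = ZetaLaplace.P0 z) ∧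
      AnalyticOnNhd ℂ ZetaLaplace.f (ZetaLaplace.strip (1 / 2) 4) ∧
      ∀ s ∈ ZetaLaplace.strip (1 / 2) 4,
        Integrable (ZetaLaplace.laplaceIntegrand ZetaLaplace.P0 s) ∧
        ZetaLaplace.f s = ∫ y : ℝ, ZetaLaplace.laplaceIntegrand ZetaLaplace.P0 s y) ∧
    -- (2)
    ((∀ k : ℤ, deriv ZetaLaplace.n (4 * k) ≠ 0) ∧
      (∀ s ∉ ZetaLaplace.fourN, Summable fun w : ℕ => ‖ZetaLaplace.FTerm s (w + 1)‖) ∧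
      (∃ h : ℂ → ℂ, AnalyticOnNhd ℂ h ZetaLaplace.Ziᶜ ∧
        ∀ s ∉ ZetaLaplace.fourZ ∪ ZetaLaplace.Zi, h s = ZetaLaplace.f s - ZetaLaplace.pr s) ∧
      IsOpen ZetaLaplace.Ziᶜ ∧
      {s : ℂ | 1 / 2 ≤ |s.re|} ⊆ ZetaLaplace.Ziᶜ) ∧
    -- (3)
    (∀ s : ℂ, s.re < 4 →
      IntegrableOn (ZetaLaplace.laplaceIntegrand ZetaLaplace.P0 s) (Ioi 0) ∧
      ZetaLaplace.F s = ∫ y in Ioi (0 : ℝ), ZetaLaplace.laplaceIntegrand ZetaLaplace.P0 s y) ∧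
    -- (4)
    (∀ w : ℕ, 1 ≤ w →
      Differentiable ℂ (ZetaLaplace.P w) ∧
      (∀ z, HasSum (fun k : ℕ =>
          (-1) ^ (w + 1) * (ZetaLaplace.ctilde (w + 1 + k) * (-z ^ 2) ^ (w + 1 + k)))
        (ZetaLaplace.P w z)) ∧
      AnalyticOnNhd ℂ ZetaLaplace.f (ZetaLaplace.strip (4 * w) (4 * w + 4)) ∧
      (∀ s ∈ ZetaLaplace.strip (4 * w) (4 * w + 4),
        Integrable (ZetaLaplace.laplaceIntegrand (ZetaLaplace.P w) s) ∧
        (-1) ^ w * ZetaLaplace.f s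
          = ∫ y : ℝ, ZetaLaplace.laplaceIntegrand (ZetaLaplace.P w) s y) ∧
      ∀ y : ℝ,
        (ZetaLaplace.P w ((Real.pi * Real.exp (-2 * y) : ℝ) : ℂ)).im = 0 ∧
        0 < (ZetaLaplace.P w ((Real.pi * Real.exp (-2 * y) : ℝ) : ℂ)).re) := by
  refine ⟨⟨ZetaLaplace.summable_P0Term, ZetaLaplace.differentiable_P0, ZetaLaplace.P0_neg,
      ZetaLaplace.analyticOnNhd_f_strip 0 le_rfl (by norm_num) (by norm_num), fun s hs => ?_⟩,
    ⟨ZetaLaplace.deriv_n_four_mul_ne_zero, fun s _ => ZetaLaplace.summable_norm_FTerm s,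
      ZetaLaplace.exists_analytic_extension_f_sub_pr, ZetaLaplace.isOpen_compl_Zi,
      ZetaLaplace.half_le_abs_re_subset_compl_Zi⟩,
    fun s hs => ZetaLaplace.laplace_half_line hs,
    fun w hw => ⟨ZetaLaplace.differentiable_P w, ZetaLaplace.hasSum_P w, ?_, fun s hs => ?_,
      fun y => ZetaLaplace.P_pos hw (by positivity)⟩⟩
  · have hs1 : 0 < s.re := by linarith [hs.1]
    have h := ZetaLaplace.laplace_P 0 hs.1 (by simpa using hs1) (by simpa using hs.2)
    rw [ZetaLaplace.P_zero, pow_zero, one_mul] at h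
    exact ⟨h.1, h.2.symm⟩
  · have hw' : (1 : ℝ) ≤ w := by exact_mod_cast hw
    exact ZetaLaplace.analyticOnNhd_f_strip w (by linarith) le_rfl le_rfl
  · have hw' : (1 : ℝ) ≤ w := by exact_mod_cast hw
    have h := ZetaLaplace.laplace_P w (by linarith [hs.1]) hs.1 hs.2
    exact ⟨h.1, h.2.symm⟩
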